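/- For a quadratic differential $Q$ on $\mathbb{CP}^1$ let the canonical cover $\widehat{\mathcal C}$ be the curve $v^2=Q$, with its Abelian differential $v=\sqrt Q$. In both cases below $\widehat{\mathcal C}$ is an elliptic curve. A canonical pair of cycles $(a,b)$ is a pair of cycles on $\widehat{\mathcal C}$, avoiding the zeros and poles of $v$, with intersection number $a\circ b=+1$; as $Q$ varies locally, the cycles are transported continuously (their projections to the $x$-plane can be kept fixed). Put $A=\oint_a v$, $B=\oint_b v$. (1) Let $Q=(x-x_1)(x-x_2)(x-x_3)(dx)^2$ with $x_3=-x_1-x_2$ and $x_1,x_2,x_3$ pairwise distinct, representing a point of $$\mathcal Q_0(-7,[1]^3)=\{(x_1,x_2,x_3)\in\mathbb C^3:\ x_1+x_2+x_3=0,\ x_i\ne x_j\}/(S_3\times\mathbb Z_5),$$ where $S_3$ permutes the $x_i$ and $\mathbb Z_5$ multiplies all $x_i$ by fifth roots of unity. Then $(A,B)$ is a holomorphic function of $(x_1,x_2)$, and $$\frac{\partial(A,B)}{\partial(x_1,x_2)}=2\pi i\,\Delta_1^{1/2},\qquad \Delta_1^{1/2}=(x_1-x_2)(x_1-x_3)(x_2-x_3),$$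 where $\Delta_1=[(x_1-x_2)(x_1-x_3)(x_2-x_3)]^2$. Equivalently, the half-periods $\tfrac12A,\tfrac12B$ have Jacobian $\tfrac{\pi i}{2}\Delta_1^{1/2}$. Both $(A,B)$ and $(\tfrac12A,\tfrac12B)$ are local holomorphic coordinates on $\mathcal Q_0(-7,[1]^3)$. (2) Let $Q=\dfrac{(x-x_1)(x-x_2)}{x^3}(dx)^2$ with $x_1,x_2\in\mathbb C^*$, $x_1\neq x_2$, representing a point of $\mathcal Q_0([-3]^2,[1]^2)=\{(x_1,x_2)\in(\mathbb C^*)^2:\ x_1\ne x_2\}/S_2$. Then $(A,B)$ is a holomorphic function of $(x_1,x_2)$, and $$\frac{\partial(A,B)}{\partial(x_1,x_2)}=-2\pi i\,\frac{x_1-x_2}{x_1x_2}$$ (the sign becomes $+$ if the opposite orientation $a\circ b=-1$ is used), and $(A,B)$ are local holomorphic coordinates on $\mathcal Q_0([-3]^2,[1]^2)$. -/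

import Mathlib

open Set Filter Topology MeasureTheory

noncomputable section

namespace QuadDiff

/-! ### Cycles on canonical covers and their periods

A family `Q_u = q u x (dx)^2` of quadratic differentials on the Riemann sphere depends on a parameter
`u = (x₁, x₂)`.  Away from the zeros and poles of `Q_u`, the canonical cover `v^2 = Q_u` is the curve
`w^2 = q u x`, `w ≠ 0`, with coordinates `(x, w)`, and `v = w dx` on it; `x` is a local holomorphic
coordinate at each point of this curve. -/

/-- A cycle on the canonical covers `w^2 = q u x`, transported continuously over all `u ∈ U`:
a family of closed `C^1` loops `t ↦ (x t, w u t)`, `t ∈ ℝ / ℤ`, avoiding the zeros and poles of `v`, jointly continuous in `(u, t)`, whose projection to the `x`-plane stays fixed.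
For the families below, `w ≠ 0` excludes the zeros of `Q_u` and also its finite poles, since there
`q u x = 0` by the convention `1 / 0 = 0`. -/
structure CycleFamily (q : ℂ × ℂ → ℂ → ℂ) (U : Set (ℂ × ℂ)) where
  x : ℝ → ℂ
  w : ℂ × ℂ → ℝ → ℂ
  contDiff_x : ContDiff ℝ 1 x
  periodic_x : Function.Periodic x 1
  periodic_w : ∀ u ∈ U, Function.Periodic (w u) 1
  continuousOn_w : ContinuousOn (fun p : (ℂ × ℂ) × ℝ => w p.1 p.2) (U ×ˢ univ)
  sq_w : ∀ u ∈ U, ∀ t, w u t ^ 2 = q u (x t)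
  w_ne_zero : ∀ u ∈ U, ∀ t, w u t ≠ 0

variable {q : ℂ × ℂ → ℂ → ℂ} {U : Set (ℂ × ℂ)}

/-- The period `∮ v = ∮ w dx` of the Abelian differential `v` on the cover with parameter `u`. -/
def CycleFamily.period (c : CycleFamily q U) (u : ℂ × ℂ) : ℂ :=
  ∫ t in (0 : ℝ)..1, c.w u t * deriv c.x t

/-- The pairs of times at which two loops pass through the same point of the cover. -/
def crossings (a b : CycleFamily q U) (u : ℂ × ℂ) : Set (ℝ × ℝ) :=
  {p | p.1 ∈ Ico (0 : ℝ) 1 ∧ p.2 ∈ Ico (0 : ℝ) 1 ∧ a.x p.1 = b.x p.2 ∧ a.w u p.1 = b.w u p.2}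

/-- The oriented area spanned by the velocities of `a` at time `p.1` and of `b` at time `p.2`, in the
holomorphic coordinate `x`. -/
def crossingArea (a b : CycleFamily q U) (p : ℝ × ℝ) : ℝ :=
  ((starRingEnd ℂ) (deriv a.x p.1) * deriv b.x p.2).im

/-- The two loops meet only transversally (hence only finitely often). -/
def Transverse (a b : CycleFamily q U) (u : ℂ × ℂ) : Prop :=
  ∀ p ∈ crossings a b u, crossingArea a b p ≠ 0

/-- The algebraic intersection number `a ∘ b` of transverse loops: the sum of the signs of crossings. -/
def intersectionNumber (a b : CycleFamily q U) (u : ℂ × ℂ) : ℤ :=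
  ∑ᶠ p ∈ crossings a b u, ((SignType.sign (crossingArea a b p) : SignType) : ℤ)

/-- `(a, b)` is a canonical pair of cycles on the canonical cover (a torus): `a ∘ b = 1`. -/
def IsCanonicalPair (a b : CycleFamily q U) (u : ℂ × ℂ) : Prop :=
  Transverse a b u ∧ intersectionNumber a b u = 1

/-- The map `(x₁, x₂) ↦ (∮_a v, ∮_b v)`. -/
def periodMap (a b : CycleFamily q U) (u : ℂ × ℂ) : ℂ × ℂ :=
  (a.period u, b.period u)

/-- The map `(x₁, x₂) ↦ (½ ∮_a v, ½ ∮_b v)`. -/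
def halfPeriodMap (a b : CycleFamily q U) (u : ℂ × ℂ) : ℂ × ℂ :=
  (a.period u / 2, b.period u / 2)

/-- The Jacobian determinant `∂(F₁, F₂) / ∂(x₁, x₂)`. -/
def jacobian (F : ℂ × ℂ → ℂ × ℂ) (u : ℂ × ℂ) : ℂ :=
  (fderiv ℂ F u).det

/-- Let `cls : D → M` be a parametrization of a space `M` by a domain `D` in `ℂ²`.  The components of
`F` are local holomorphic coordinates on `M` at the class of `p`: on a neighbourhood of `p` in `D`,
the map `cls` is a homeomorphism onto an open subset of `M`, and `F` is a biholomorphism onto an open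
subset of `ℂ²`. -/
def IsLocalCoordinatesAt {M : Type*} [TopologicalSpace M] {D : Set (ℂ × ℂ)} (cls : D → M)
    (F : ℂ × ℂ → ℂ × ℂ) (p : ℂ × ℂ) : Prop :=
  ∃ e : OpenPartialHomeomorph (ℂ × ℂ) (ℂ × ℂ),
    p ∈ e.source ∧ EqOn e F e.source ∧
    DifferentiableOn ℂ e e.source ∧ DifferentiableOn ℂ e.symm e.target ∧
    ∃ h : e.source ⊆ D, IsOpenEmbedding (fun u : e.source => cls ⟨u, h u.2⟩)

/-! ### The stratum `Q_0(-7, [1]^3)` -/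

/-- The zeros `x₁, x₂, x₃` with `x₁ + x₂ + x₃ = 0`. -/
def zeros7 (u : ℂ × ℂ) : Fin 3 → ℂ := ![u.1, u.2, -u.1 - u.2]

/-- `Q = (x - x₁)(x - x₂)(x - x₃) (dx)^2`. -/
def q7 (u : ℂ × ℂ) (x : ℂ) : ℂ :=
  (x - zeros7 u 0) * (x - zeros7 u 1) * (x - zeros7 u 2)

/-- Triples of pairwise distinct points of zero sum, given by `(x₁, x₂)`. -/
def conf7 : Set (ℂ × ℂ) := {u | Function.Injective (zeros7 u)}

/-- The equivalence generated by permutations of the zeros and by multiplication with fifth roots of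
unity. -/
def setoid7 : Setoid conf7 where
  r u u' := ∃ (σ : Equiv.Perm (Fin 3)) (ζ : ℂ), ζ ^ 5 = 1 ∧
    ∀ i, zeros7 u'.1 i = ζ * zeros7 u.1 (σ i)
  iseqv :=
    { refl := fun _ => ⟨1, 1, by simp, by simp⟩
      symm := by
        rintro u u' ⟨σ, ζ, hζ, h⟩
        have h0 : ζ ≠ 0 := by
          rintro rfl
          simp at hζ
        refine ⟨σ⁻¹, ζ⁻¹, by rw [inv_pow, hζ, inv_one], fun i => ?_⟩
        simp [h, h0]
      trans := by
        rintro u u' u'' ⟨σ, ζ, hζ, h⟩ ⟨σ', ζ', hζ', h'⟩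
        refine ⟨σ * σ', ζ' * ζ, by rw [mul_pow, hζ, hζ', one_mul], fun i => ?_⟩
        rw [h', h, Equiv.Perm.mul_apply, mul_assoc] }

/-- `Q_0(-7, [1]^3) = {(x₁, x₂, x₃) : x₁ + x₂ + x₃ = 0, xᵢ ≠ xⱼ} / (S₃ × ℤ₅)`, with the quotient topology. -/
abbrev Stratum7 : Type := Quotient setoid7

def cls7 (u : conf7) : Stratum7 := Quotient.mk setoid7 u

/-- The square root `(x₁ - x₂)(x₁ - x₃)(x₂ - x₃)` of `Δ₁`. -/
def sqrtDisc (u : ℂ × ℂ) : ℂ :=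
  (zeros7 u 0 - zeros7 u 1) * (zeros7 u 0 - zeros7 u 2) * (zeros7 u 1 - zeros7 u 2)

/-- The modular discriminant `Δ₁`. -/
def modularDiscriminant (u : ℂ × ℂ) : ℂ :=
  ((zeros7 u 0 - zeros7 u 1) * (zeros7 u 0 - zeros7 u 2) * (zeros7 u 1 - zeros7 u 2)) ^ 2

theorem sqrtDisc_sq (u : ℂ × ℂ) : sqrtDisc u ^ 2 = modularDiscriminant u := rfl

/-! ### The stratum `Q_0([-3]^2, [1]^2)` -/

/-- `Q = (x - x₁)(x - x₂) / x^3 (dx)^2`. -/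
def q33 (u : ℂ × ℂ) (x : ℂ) : ℂ := (x - u.1) * (x - u.2) / x ^ 3

/-- Ordered pairs of distinct nonzero points. -/
def conf33 : Set (ℂ × ℂ) := {u | u.1 ≠ 0 ∧ u.2 ≠ 0 ∧ u.1 ≠ u.2}

def setoid33 : Setoid conf33 where
  r u u' := u'.1 = u.1 ∨ u'.1 = u.1.swap
  iseqv :=
    { refl := fun _ => Or.inl rfl
      symm := by
        rintro u u' (h | h)
        · exact Or.inl h.symm
        · exact Or.inr (by rw [h, Prod.swap_swap])
      trans := by
        rintro u u' u'' (h | h) (h' | h')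
        · exact Or.inl (h'.trans h)
        · exact Or.inr (by rw [h', h])
        · exact Or.inr (h'.trans h)
        · exact Or.inl (by rw [h', h, Prod.swap_swap]) }

/-- `Q_0([-3]^2, [1]^2) = {(x₁, x₂) ∈ (ℂ*)² : x₁ ≠ x₂} / S₂`, with the quotient topology. -/
abbrev Stratum33 : Type := Quotient setoid33

def cls33 (u : conf33) : Stratum33 := Quotient.mk setoid33 u

end QuadDiff

end

/-! Since the projection of a cycle to the `x`-plane is fixed, only `w = √q` varies with the
parameters, and differentiating under the integral gives `∂ᵢA = ∮ ∂ᵢq / (2w) dx`. These derivatives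
are periods on an elliptic curve `y² = x³ + c₂x² + c₁x + c₀`. For the first family `y = w`. For the
second, `y = x²w`, and `dx/(xy)` is traded for `x dx/y` modulo an exact form. The Jacobian is thus
an explicit multiple of `η_A ω_B - ω_A η_B`, where `ω`, `η` are the periods of `dx/y` and `x dx/y`.
Everything reduces to the Legendre-type relation `η_A ω_B - ω_A η_B = -8πi (a ∘ b)`, which is
`CubicLoop.bilinear_relation`.

That relation is proved without homology or dissection of the torus. For a point `(x, y)` moving
along `a`, consider the third-kind integral `T = ∮_b (y + s)/(x - t) dt/s`. The addition law shows
that off the crossings `dT = (x ω_B - η_B) dx/(2y)` (`CubicLoop.hasDerivAt_thirdKind`). Each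
transversal crossing makes `T` jump by `±4πi`, a residue computation done with two branches of the
logarithm (`exists_tendsto_cauchy_jump`). As `T` returns to its initial value after one turn of `a`,
the jumps and the integral of `dT` sum to zero.

`sum_jumps` passes from local jumps to a full period. It is used twice: along `b`, to add the jumps
of short arcs into the jump of `T`, and along `a`, to add the jumps of `T`.

The Jacobian does not vanish on distinct (and, in the second family, nonzero) zeros, so the inverse
function theorem gives charts upstairs. They descend because both finite groups act freely. -/

noncomputable section

namespace QuadDiff

/-! ### Analytic preliminaries -/

/-- A continuous square root of a differentiable nonvanishing function is differentiable. -/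
theorem hasFDerivAt_of_sq_eq {𝕜 E : Type*} [NontriviallyNormedField 𝕜] [NormedAddCommGroup E]
    [NormedSpace 𝕜 E] [NormedAlgebra 𝕜 ℂ] {f g : E → ℂ} {g' : E →L[𝕜] ℂ} {x : E}
    (hf : ContinuousAt f x) (h0 : f x ≠ 0) (hfg : ∀ᶠ y in 𝓝 x, f y ^ 2 = g y)
    (hg : HasFDerivAt g g' x) : HasFDerivAt f ((2 * f x)⁻¹ • g') x := by
  have h2 : f x + f x ≠ 0 := by rw [← two_mul]; exact mul_ne_zero two_ne_zero h0
  have hk : ContinuousAt (fun y => (f y + f x)⁻¹) x := (hf.add continuousAt_const).inv₀ h2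
  have hne : ∀ᶠ y in 𝓝 x, f y + f x ≠ 0 := (hf.add continuousAt_const).eventually_ne h2
  rw [hasFDerivAt_iff_isLittleO] at hg ⊢
  -- From `g y - g x = (f y + f x) (f y - f x)`, the remainder of `f` is the remainder of `g`
  -- divided by `f y + f x`, plus `g'` times the variation of that quotient factor.
  have e1 : (fun y => (f y + f x)⁻¹ * (g y - g x - g' (y - x))) =o[𝓝 x] fun y => y - x := by
    have := (hk.norm.isBoundedUnder_le).isBigO_one ℝ |>.mul_isLittleO hg.norm_right
    simpa using this
  have e2 : (fun y => ((f y + f x)⁻¹ - (f x + f x)⁻¹) * g' (y - x)) =o[𝓝 x] fun y => y - x := by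
    have h3 : (fun y => (f y + f x)⁻¹ - (f x + f x)⁻¹) =o[𝓝 x] fun _ => (1 : ℝ) := by
      rw [Asymptotics.isLittleO_one_iff]
      simpa using hk.tendsto.sub_const ((f x + f x)⁻¹)
    have := h3.mul_isBigO (g'.isBigO_sub (𝓝 x) x).norm_right
    simpa using this
  refine (e1.add e2).congr' ?_ EventuallyEq.rfl
  filter_upwards [hfg, hne] with y hy hy'
  have hx := hfg.self_of_nhds
  have : f y - f x = (f y + f x)⁻¹ * (g y - g x) := by
    rw [← hy, ← hx]; field_simp; ring
  rw [this, _root_.smul_apply, smul_eq_mul, two_mul]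
  ring

theorem hasDerivAt_of_sq_eq {f g : ℝ → ℂ} {g' : ℂ} {x : ℝ}
    (hf : ContinuousAt f x) (h0 : f x ≠ 0) (hfg : ∀ y, f y ^ 2 = g y)
    (hg : HasDerivAt g g' x) : HasDerivAt f (g' / (2 * f x)) x := by
  have := (hasFDerivAt_of_sq_eq hf h0 (Eventually.of_forall hfg) hg.hasFDerivAt).hasDerivAt
  convert this using 1
  simp [div_eq_inv_mul]

/-! ### Integrals depending on a parameter, with domination supplied by compactness of the interval.
-/

section Parametric

variable {X : Type*} [TopologicalSpace X] {E : Type*} [NormedAddCommGroup E]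
  {a b : ℝ} {x₀ : X} {F : X → ℝ → E}

theorem continuousOn_slice {x : X} (hF : ∀ t ∈ uIcc a b, ContinuousAt (Function.uncurry F) (x, t)) :
    ContinuousOn (F x) (uIcc a b) := fun t ht =>
  (ContinuousAt.comp (f := fun t => (x, t)) (hF t ht) (by fun_prop)).continuousWithinAt

theorem eventually_bounded_of_continuousAt
    (hF : ∀ t ∈ uIcc a b, ContinuousAt (Function.uncurry F) (x₀, t)) :
    ∃ C, ∀ᶠ x in 𝓝 x₀, ∀ t ∈ uIcc a b, ‖F x t‖ ≤ C := by
  obtain ⟨C, hC⟩ := isCompact_uIcc.exists_bound_of_continuousOn (continuousOn_slice hF)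
  refine ⟨C + 1, isCompact_uIcc.eventually_forall_of_forall_eventually fun t ht => ?_⟩
  have h1 : ‖Function.uncurry F (x₀, t)‖ < C + 1 := (hC t ht).trans_lt (by linarith)
  filter_upwards [(hF t ht).norm.eventually_lt_const h1] with z hz using hz.le

theorem eventually_continuousOn_slice
    (hF : ∀ t ∈ uIcc a b, ∀ᶠ z in 𝓝 (x₀, t), ContinuousAt (Function.uncurry F) z) :
    ∀ᶠ x in 𝓝 x₀, ContinuousOn (F x) (uIcc a b) := by
  filter_upwards [isCompact_uIcc.eventually_forall_of_forall_eventually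
    (P := fun x t => ContinuousAt (Function.uncurry F) (x, t)) hF] with x hx
  exact continuousOn_slice hx

theorem continuousAt_parametric_integral [NormedSpace ℝ E] [FirstCountableTopology X]
    (hF : ∀ t ∈ uIcc a b, ∀ᶠ z in 𝓝 (x₀, t), ContinuousAt (Function.uncurry F) z) :
    ContinuousAt (fun x => ∫ t in a..b, F x t) x₀ := by
  have hF0 : ∀ t ∈ uIcc a b, ContinuousAt (Function.uncurry F) (x₀, t) :=
    fun t ht => (hF t ht).self_of_nhds
  obtain ⟨C, hC⟩ := eventually_bounded_of_continuousAt hF0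
  refine intervalIntegral.continuousAt_of_dominated_interval (bound := fun _ => C) ?_ ?_
    intervalIntegrable_const ?_
  · filter_upwards [eventually_continuousOn_slice hF] with x hx
    exact (hx.mono uIoc_subset_uIcc).aestronglyMeasurable measurableSet_uIoc
  · filter_upwards [hC] with x hx
    exact Eventually.of_forall fun t ht => hx t (uIoc_subset_uIcc ht)
  · exact Eventually.of_forall fun t ht =>
      ContinuousAt.comp (f := fun x => (x, t)) (hF0 t (uIoc_subset_uIcc ht)) (by fun_prop)

theorem hasDerivAt_parametric_integral {F F' : ℝ → ℝ → ℂ} {x₀ : ℝ}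
    (hF : ∀ t ∈ uIcc a b, ∀ᶠ z in 𝓝 (x₀, t), ContinuousAt (Function.uncurry F) z)
    (hF' : ∀ t ∈ uIcc a b, ∀ᶠ z in 𝓝 (x₀, t), ContinuousAt (Function.uncurry F') z)
    (hd : ∀ t ∈ uIcc a b, ∀ᶠ z in 𝓝 (x₀, t), HasDerivAt (fun x => F x z.2) (F' z.1 z.2) z.1) :
    HasDerivAt (fun x => ∫ t in a..b, F x t) (∫ t in a..b, F' x₀ t) x₀ := by
  obtain ⟨C, hC⟩ := eventually_bounded_of_continuousAt fun t ht => (hF' t ht).self_of_nhds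
  have hd' := isCompact_uIcc.eventually_forall_of_forall_eventually
    (P := fun x t => HasDerivAt (fun x => F x t) (F' x t) x) hd
  have hm := eventually_continuousOn_slice hF
  refine (intervalIntegral.hasDerivAt_integral_of_dominated_loc_of_deriv_le (𝕜 := ℝ)
    (bound := fun _ => C) (F' := F') (hC.and hd')
    (hm.mono fun x hx => (hx.mono uIoc_subset_uIcc).aestronglyMeasurable measurableSet_uIoc)
    hm.self_of_nhds.intervalIntegrable
    (((eventually_continuousOn_slice hF').self_of_nhds.mono
      uIoc_subset_uIcc).aestronglyMeasurable measurableSet_uIoc)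
    (Eventually.of_forall fun t ht x hx => hx.1 t (uIoc_subset_uIcc ht))
    intervalIntegrable_const
    (Eventually.of_forall fun t ht x hx => hx.2 t (uIoc_subset_uIcc ht))).2

theorem hasFDerivAt_parametric_integral {H : Type*} [NormedAddCommGroup H] [NormedSpace ℂ H]
    {F : H → ℝ → ℂ} {F' : H → ℝ → H →L[ℂ] ℂ} {x₀ : H}
    (hF : ∀ t ∈ uIcc a b, ∀ᶠ z in 𝓝 (x₀, t), ContinuousAt (Function.uncurry F) z)
    (hF' : ∀ t ∈ uIcc a b, ∀ᶠ z in 𝓝 (x₀, t), ContinuousAt (Function.uncurry F') z)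
    (hd : ∀ t ∈ uIcc a b, ∀ᶠ z in 𝓝 (x₀, t), HasFDerivAt (fun x => F x z.2) (F' z.1 z.2) z.1) :
    HasFDerivAt (fun x => ∫ t in a..b, F x t) (∫ t in a..b, F' x₀ t) x₀ := by
  obtain ⟨C, hC⟩ := eventually_bounded_of_continuousAt fun t ht => (hF' t ht).self_of_nhds
  have hd' := isCompact_uIcc.eventually_forall_of_forall_eventually
    (P := fun x t => HasFDerivAt (fun x => F x t) (F' x t) x) hd
  have hm := eventually_continuousOn_slice hF
  exact intervalIntegral.hasFDerivAt_integral_of_dominated_of_fderiv_le (𝕜 := ℂ)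
    (bound := fun _ => C) (F' := F') (hC.and hd')
    (hm.mono fun x hx => (hx.mono uIoc_subset_uIcc).aestronglyMeasurable measurableSet_uIoc)
    hm.self_of_nhds.intervalIntegrable
    (((eventually_continuousOn_slice hF').self_of_nhds.mono
      uIoc_subset_uIcc).aestronglyMeasurable measurableSet_uIoc)
    (Eventually.of_forall fun t ht x hx => hx.1 t (uIoc_subset_uIcc ht))
    intervalIntegrable_const
    (Eventually.of_forall fun t ht x hx => hx.2 t (uIoc_subset_uIcc ht))

end Parametric

/-! ### Adding up local jumps -/

/-- The step function with jump `J s` at every point of `s + ℤ`. -/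
def stepSum (S : Finset ℝ) (J : ℝ → ℂ) (x : ℝ) : ℂ := ∑ s ∈ S, J s * (⌈x - s⌉ : ℤ)

theorem stepSum_add_one (S : Finset ℝ) (J : ℝ → ℂ) (x : ℝ) :
    stepSum S J (x + 1) = stepSum S J x + ∑ s ∈ S, J s := by
  simp only [stepSum, ← Finset.sum_add_distrib]
  refine Finset.sum_congr rfl fun s _ => ?_
  rw [add_sub_right_comm, Int.ceil_add_one]
  push_cast; ring

/-- The ceiling is left-continuous and jumps by one just after an integer, so passing `x` from left
to right is felt exactly when `x ∈ s + ℤ`. -/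
theorem eventually_ceil_sub (x s : ℝ) (hs : s ∈ Ico (0 : ℝ) 1) :
    ∀ᶠ z in 𝓝[<] x ×ˢ 𝓝[>] x,
      ⌈z.2 - s⌉ - ⌈z.1 - s⌉ = if Int.fract x = s then (1 : ℤ) else 0 := by
  have hl : ∀ᶠ z in 𝓝[<] x, ⌈z - s⌉ = ⌈x - s⌉ := by
    have h1 : Tendsto (fun z : ℝ => z - s) (𝓝[<] x) (𝓝[≤] (x - s)) := by
      refine tendsto_nhdsWithin_iff.2 ⟨?_, ?_⟩
      · exact ((continuous_id.sub continuous_const).tendsto x).mono_left nhdsWithin_le_nhds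
      · filter_upwards [self_mem_nhdsWithin] with z hz
        exact sub_le_sub_right (le_of_lt hz) s
    exact tendsto_pure.1 ((tendsto_ceil_left_pure_ceil (x - s)).comp h1)
  have hr : ∀ᶠ z in 𝓝[>] x, ⌈z - s⌉ = ⌊x - s⌋ + 1 := by
    have h1 : Tendsto (fun z : ℝ => z - s) (𝓝[>] x) (𝓝[>] (x - s)) := by
      refine tendsto_nhdsWithin_iff.2 ⟨?_, ?_⟩
      · exact ((continuous_id.sub continuous_const).tendsto x).mono_left nhdsWithin_le_nhds
      · filter_upwards [self_mem_nhdsWithin] with z hz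
        exact sub_lt_sub_right hz s
    exact tendsto_pure.1 ((tendsto_ceil_right_pure_floor_add_one (x - s)).comp h1)
  filter_upwards [hl.prod_mk hr] with z hz
  rw [hz.1, hz.2]
  split_ifs with h
  · have : x - s = (⌊x⌋ : ℝ) := by rw [← h, Int.self_sub_fract]
    rw [this, Int.ceil_intCast, Int.floor_intCast]; ring
  · have : ⌊x - s⌋ + 1 = ⌈x - s⌉ := by
      symm
      rw [Int.ceil_eq_iff]
      push_cast
      refine ⟨?_, (Int.lt_floor_add_one _).le⟩
      rw [add_sub_cancel_right]
      refine lt_of_le_of_ne (Int.floor_le _) fun he => h ?_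
      have : x = s + (⌊x - s⌋ : ℤ) := by linarith
      rw [this, Int.fract_add_intCast, Int.fract_eq_self.2 hs]
    omega

theorem eventually_stepSum_sub (S : Finset ℝ) (hS : ∀ s ∈ S, s ∈ Ico (0 : ℝ) 1) {J : ℝ → ℂ}
    (hJ : Function.Periodic J 1) (h0 : ∀ x, J x ≠ 0 → Int.fract x ∈ S) (x : ℝ) :
    ∀ᶠ z in 𝓝[<] x ×ˢ 𝓝[>] x, stepSum S J z.2 - stepSum S J z.1 = J x := by
  have h1 : ∀ᶠ z in 𝓝[<] x ×ˢ 𝓝[>] x, ∀ s ∈ S,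
      ⌈z.2 - s⌉ - ⌈z.1 - s⌉ = if Int.fract x = s then (1 : ℤ) else 0 :=
    (eventually_all_finset S).2 fun s hs => eventually_ceil_sub x s (hS s hs)
  filter_upwards [h1] with z hz
  have hJx : J (Int.fract x) = J x := by
    have := hJ.sub_zsmul_eq (x := x) ⌊x⌋
    rwa [zsmul_eq_mul, mul_one] at this
  have : stepSum S J z.2 - stepSum S J z.1 = ∑ s ∈ S, if Int.fract x = s then J s else 0 := by
    simp only [stepSum, ← Finset.sum_sub_distrib]
    refine Finset.sum_congr rfl fun s hs => ?_
    have := hz s hs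
    rw [← mul_sub, ← Int.cast_sub, this]
    split_ifs <;> simp
  rw [this, Finset.sum_ite_eq]
  split_ifs with h
  · exact hJx
  · by_contra hne
    exact h (h0 x (Ne.symm hne))

/-- An additive defect with local jumps `J` has the defect `∑ J` over a generic full period. -/
theorem sum_jumps (V : ℝ → ℝ → ℂ → Prop)
    (htrans : ∀ x y z c d, V x y c → V y z d → V x z (c + d))
    (hsymm : ∀ x y c, V x y c → V y x (-c))
    (S : Finset ℝ) (hS : ∀ s ∈ S, s ∈ Ico (0 : ℝ) 1) {J : ℝ → ℂ}
    (hJ : Function.Periodic J 1) (h0 : ∀ x, J x ≠ 0 → Int.fract x ∈ S)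
    (hloc : ∀ x, ∀ᶠ z in 𝓝[<] x ×ˢ 𝓝[>] x, V z.1 z.2 (J x)) :
    ∃ c, V c (c + 1) (∑ s ∈ S, J s) := by
  -- Subtracting the step function with the same jumps leaves a relation without local defect.
  set R : ℝ → ℝ → Prop := fun x y => V x y (stepSum S J y - stepSum S J x) with hR
  have Rt : ∀ x y z, R x y → R y z → R x z := fun x y z h h' => by
    have := htrans _ _ _ _ _ h h'
    simp only [hR]
    convert this using 1; ring
  have Rs : ∀ x y, R x y → R y x := fun x y h => by
    have := hsymm _ _ _ h
    simp only [hR]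
    convert this using 1; ring
  have hRloc : ∀ x, ∀ᶠ z in 𝓝[<] x ×ˢ 𝓝[>] x, R z.1 z.2 := fun x => by
    filter_upwards [hloc x, eventually_stepSum_sub S hS hJ h0 x] with z hz hz'
    simp only [hR, hz']; exact hz
  have hloc2 : ∀ x, ∃ U ∈ 𝓝[≠] x, ∀ y ∈ U, ∀ z ∈ U, R y z := fun x => by
    obtain ⟨pa, ha, pb, hb, hab⟩ := eventually_prod_iff.1 (hRloc x)
    obtain ⟨l, hl⟩ := ha.exists
    obtain ⟨r, hr⟩ := hb.exists
    refine ⟨{y | y ≠ x ∧ (y < x → pa y) ∧ (x < y → pb y)}, ?_, ?_⟩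
    · rw [← Iio_union_Ioi, nhdsWithin_union]
      refine ⟨?_, ?_⟩
      · filter_upwards [ha, self_mem_nhdsWithin] with y hy hyx
        exact ⟨ne_of_lt hyx, fun _ => hy, fun h => absurd h (not_lt.2 (le_of_lt hyx))⟩
      · filter_upwards [hb, self_mem_nhdsWithin] with y hy hyx
        exact ⟨ne_of_gt hyx, fun h => absurd h (not_lt.2 (le_of_lt hyx)), fun _ => hy⟩
    · have key : ∀ y, y ≠ x ∧ (y < x → pa y) ∧ (x < y → pb y) → R y r := by
        rintro y ⟨hne, h1, h2⟩
        rcases lt_or_gt_of_ne hne with h | h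
        · exact hab (h1 h) hr
        · exact Rt _ _ _ (Rs _ _ (hab hl (h2 h))) (hab hl hr)
      exact fun y hy z hz => Rt _ _ _ (key y hy) (Rs _ _ (key z hz))
  -- `R` is controlled only away from each centre, so `Q` compares germs of punctured
  -- neighbourhoods. Its classes are open, and connectedness of `ℝ` relates `0` to `1`.
  set Q : ℝ → ℝ → Prop := fun x y => ∃ U ∈ 𝓝[≠] x, ∃ W ∈ 𝓝[≠] y, ∀ u ∈ U, ∀ w ∈ W, R u w
  have Qt : ∀ x y z, Q x y → Q y z → Q x z := by
    rintro x y z ⟨U, hU, W, hW, h⟩ ⟨U', hU', W', hW', h'⟩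
    obtain ⟨v, hv, hv'⟩ := Filter.nonempty_of_mem (inter_mem hW hU')
    exact ⟨U, hU, W', hW', fun u hu w hw => Rt _ _ _ (h u hu v hv) (h' v hv' w hw)⟩
  have Qs : ∀ x y, Q x y → Q y x := by
    rintro x y ⟨U, hU, W, hW, h⟩
    exact ⟨W, hW, U, hU, fun w hw u hu => Rs _ _ (h u hu w hw)⟩
  have Qloc : ∀ y, ∀ᶠ y' in 𝓝 y, Q y y' := fun y => by
    obtain ⟨U, hU, h⟩ := hloc2 y
    have h2 : ∀ᶠ y' in 𝓝[≠] y, Q y y' := by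
      filter_upwards [eventually_eventually_nhdsWithin.2 hU, self_mem_nhdsWithin] with y' hy' hne
      refine ⟨U, hU, U, ?_, h⟩
      rw [isOpen_compl_singleton.nhdsWithin_eq hne] at hy'
      exact mem_nhdsWithin_of_mem_nhds hy'
    rw [eventually_nhdsWithin_iff] at h2
    filter_upwards [h2] with y' hy'
    by_cases he : y' = y
    · subst he; exact ⟨U, hU, U, hU, h⟩
    · exact hy' he
  have hlc : IsLocallyConstant (fun y => Q 0 y) := by
    rw [IsLocallyConstant.iff_eventually_eq]
    intro y
    filter_upwards [Qloc y] with y' hy'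
    exact propext ⟨fun h => Qt _ _ _ h (Qs _ _ hy'), fun h => Qt _ _ _ h hy'⟩
  have h01 : Q 0 1 := by
    have := hlc.apply_eq_of_preconnectedSpace 0 1
    exact this ▸ (Qloc 0).self_of_nhds
  obtain ⟨U, hU, W, hW, h⟩ := h01
  have hT : Tendsto (fun x : ℝ => x + 1) (𝓝[≠] 0) (𝓝[≠] 1) := by
    refine tendsto_nhdsWithin_iff.2 ⟨?_, ?_⟩
    · have : Continuous (fun x : ℝ => x + 1) := by fun_prop
      simpa using (this.tendsto 0).mono_left nhdsWithin_le_nhds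
    · filter_upwards [self_mem_nhdsWithin] with x hx
      simpa using hx
  -- A base point near `0` for which both `c` and `c + 1` are generic; `0` itself may be a jump.
  obtain ⟨c, hc, hc'⟩ := Filter.nonempty_of_mem (inter_mem hU (hT hW))
  refine ⟨c, ?_⟩
  have := h c hc (c + 1) hc'
  simp only [hR, stepSum_add_one, add_sub_cancel_left] at this
  exact this

/-! ### The jump of a Cauchy integral across a transversal crossing -/

/-- As `σ` is not real, `e σ + t` with `t ≥ 0` stays at distance comparable to `|e| + t` from the
negative real axis, which absorbs a small linear error. -/
theorem exists_add_mem_slitPlane {σ : ℂ} (hσ : σ.im ≠ 0) :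
    ∃ c > 0, ∀ (e t : ℝ) (w : ℂ), 0 ≤ t → (e ≠ 0 ∨ t ≠ 0) → ‖w‖ ≤ c * (|e| + t) →
      e * σ + t + w ∈ Complex.slitPlane := by
  set m := |σ.im| with hm
  set M := ‖σ‖ with hM
  have hm0 : 0 < m := abs_pos.2 hσ
  have hmM : m ≤ M := Complex.abs_im_le_norm σ
  have hre : |σ.re| ≤ M := Complex.abs_re_le_norm σ
  -- If the sum were off the slit plane, its zero imaginary part would force `8 (M + 1) |e| ≤ |e| +
  -- t` for this `c`. Then `t` dominates the real part, which would be positive.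
  set c := m / (8 * (M + 1)) with hc
  have hc0 : 0 < c := by positivity
  have hcm : c * (8 * (M + 1)) = m := by rw [hc]; exact div_mul_cancel₀ _ (by positivity)
  refine ⟨c, hc0, fun e t w ht het hw => ?_⟩
  rw [Complex.mem_slitPlane_iff]
  by_contra! hcon
  obtain ⟨h1, h2⟩ := hcon
  have hwr := (Complex.abs_re_le_norm w).trans hw
  have hwi := (Complex.abs_im_le_norm w).trans hw
  simp only [Complex.add_re, Complex.mul_re, Complex.ofReal_re, Complex.ofReal_im, zero_mul,
    sub_zero, Complex.add_im, Complex.mul_im, add_zero] at h1 h2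
  have he : |e| * m ≤ c * (|e| + t) := by
    rw [hm, ← abs_mul, show e * σ.im = - w.im by linarith, abs_neg]; exact hwi
  have hers : |e * σ.re| ≤ |e| * M := by
    rw [abs_mul]; exact mul_le_mul_of_nonneg_left hre (abs_nonneg e)
  have h3 := neg_abs_le (e * σ.re)
  have h4 := neg_abs_le w.re
  have hae := abs_nonneg e
  have hM0 : 0 ≤ M := norm_nonneg σ
  have hc8 : c * 8 ≤ 1 := by nlinarith
  have h5 : 8 * (M + 1) * |e| ≤ |e| + t := by
    have : c * (8 * (M + 1) * |e|) ≤ c * (|e| + t) := by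
      calc c * (8 * (M + 1) * |e|) = |e| * m := by rw [← hcm]; ring
        _ ≤ _ := he
    exact le_of_mul_le_mul_left this hc0
  have h6 : c * (|e| + t) * 8 ≤ |e| + t := by nlinarith
  have hMe : 0 ≤ M * |e| := by positivity
  have ht0 : t = 0 := by nlinarith
  have he0 : |e| = 0 := by nlinarith
  rcases het with h | h
  · exact h (abs_eq_zero.1 he0)
  · exact h ht0

theorem im_div_eq (α β : ℂ) :
    (α / β).im = -((starRingEnd ℂ) α * β).im / Complex.normSq β := by
  simp only [Complex.div_im, Complex.mul_im, Complex.conj_re, Complex.conj_im]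
  ring

variable {a b : ℝ → ℂ} {α β : ℂ} {p₀ q₀ : ℝ}

/-- To first order `(a p - b q) / β` is `(p - p₀) α / β + (q₀ - q)`. Hence the principal logarithm
is available for it when `q ≤ q₀`, and for its negative when `q ≥ q₀`. -/
theorem exists_slitPlane_box (ha : HasDerivAt a α p₀) (hb : HasDerivAt b β q₀)
    (hab : a p₀ = b q₀) (hβ : β ≠ 0) (hσ : (α / β).im ≠ 0) :
    ∃ δ > 0, ∀ p q, |p - p₀| < δ → |q - q₀| < δ → (p ≠ p₀ ∨ q ≠ q₀) →
      (q ≤ q₀ → (a p - b q) / β ∈ Complex.slitPlane) ∧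
      (q₀ ≤ q → -((a p - b q) / β) ∈ Complex.slitPlane) := by
  obtain ⟨c, hc, H⟩ := exists_add_mem_slitPlane hσ
  have hβ' : 0 < ‖β‖ := norm_pos_iff.2 hβ
  have ha' := (hasDerivAt_iff_isLittleO.1 ha).def (mul_pos hc hβ')
  have hb' := (hasDerivAt_iff_isLittleO.1 hb).def (mul_pos hc hβ')
  obtain ⟨δ₁, h1, h1'⟩ := Metric.eventually_nhds_iff.1 ha'
  obtain ⟨δ₂, h2, h2'⟩ := Metric.eventually_nhds_iff.1 hb'
  refine ⟨min δ₁ δ₂, lt_min h1 h2, fun p q hp hq hne => ?_⟩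
  have e1 := h1' (y := p) (by rw [Real.dist_eq]; exact hp.trans_le (min_le_left _ _))
  have e2 := h2' (y := q) (by rw [Real.dist_eq]; exact hq.trans_le (min_le_right _ _))
  simp only [Real.norm_eq_abs, Complex.real_smul] at e1 e2
  set w : ℂ := ((a p - a p₀ - (p - p₀ : ℝ) * α) - (b q - b q₀ - (q - q₀ : ℝ) * β)) / β with hw
  have hwn : ‖w‖ ≤ c * (|p - p₀| + |q - q₀|) := by
    rw [hw, norm_div, div_le_iff₀ hβ']
    refine (norm_sub_le _ _).trans ((add_le_add e1 e2).trans (le_of_eq ?_))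
    ring
  have heq : (a p - b q) / β = (p - p₀ : ℝ) * (α / β) + (q₀ - q : ℝ) + w := by
    rw [hw, hab]; push_cast; field_simp; ring
  refine ⟨fun hle => ?_, fun hle => ?_⟩
  · rw [heq]
    refine H _ _ _ (by linarith) ?_ ?_
    · rcases hne with h | h
      · exact Or.inl (sub_ne_zero.2 h)
      · exact Or.inr (sub_ne_zero.2 (Ne.symm h))
    · rw [abs_sub_comm q, abs_of_nonneg (sub_nonneg.2 hle)] at hwn; exact hwn
  · have heq' : -((a p - b q) / β) = ((p₀ - p : ℝ) : ℂ) * (α / β) + (q - q₀ : ℝ) + -w := by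
      rw [heq]; push_cast; ring
    rw [heq']
    refine H _ _ _ (by linarith) ?_ ?_
    · rcases hne with h | h
      · exact Or.inl (sub_ne_zero.2 (Ne.symm h))
      · exact Or.inr (sub_ne_zero.2 h)
    · rw [abs_of_nonneg (sub_nonneg.2 hle), abs_sub_comm p] at hwn
      rw [norm_neg]; exact hwn

theorem log_sub_log_neg {z : ℂ} (hz : z.im ≠ 0) :
    Complex.log z - Complex.log (-z) = (SignType.sign z.im : ℤ) * (Real.pi * Complex.I) := by
  rcases lt_or_gt_of_ne hz with h | h
  · rw [sign_neg h]
    simp only [Complex.log, norm_neg, Complex.arg_neg_eq_arg_add_pi_of_im_neg h]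
    push_cast; simp; ring
  · rw [sign_pos h]
    simp only [Complex.log, norm_neg, Complex.arg_neg_eq_arg_sub_pi_of_im_pos h]
    push_cast; simp; ring

/-- The sign of the imaginary part of a function with a transversal zero. -/
theorem eventually_sign_im {f : ℝ → ℂ} {σ : ℂ} (hf : HasDerivAt f σ p₀) (h0 : f p₀ = 0)
    (hσ : σ.im ≠ 0) :
    ∀ᶠ p in 𝓝[≠] p₀, (SignType.sign (f p).im) = SignType.sign (p - p₀) * SignType.sign σ.im := by
  have h1 := Complex.imCLM.continuous.continuousAt.tendsto.comp (hasDerivAt_iff_tendsto_slope.1 hf)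
  have h2 : ∀ᶠ p in 𝓝[≠] p₀, SignType.sign (Complex.imCLM (slope f p₀ p))
      = SignType.sign σ.im := by
    rcases lt_or_gt_of_ne hσ with h | h
    · filter_upwards [h1.eventually_lt_const h] with p hp
      exact (sign_neg hp).trans (sign_neg h).symm
    · filter_upwards [h1.eventually_const_lt h] with p hp
      exact (sign_pos hp).trans (sign_pos h).symm
  filter_upwards [h2, self_mem_nhdsWithin] with p hp hne
  have hne' : p - p₀ ≠ 0 := sub_ne_zero.2 hne
  have : (f p).im = (p - p₀) * Complex.imCLM (slope f p₀ p) := by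
    rw [slope_def_module, h0, sub_zero]
    simp only [Complex.imCLM_apply, Complex.smul_im, smul_eq_mul]
    field_simp
  rw [this, sign_mul, hp]

/-- Each half of the arc has its own logarithmic primitive; the last bracket is their mismatch at
`q₀`, the only source of the jump. -/
theorem integral_cauchy_eq_log (hb : ContDiff ℝ 1 b) (hβ : β ≠ 0) {z : ℂ} {q₁ q₂ : ℝ}
    (h1 : q₁ ≤ q₀) (h2 : q₀ ≤ q₂)
    (hl : ∀ q ∈ Icc q₁ q₀, (z - b q) / β ∈ Complex.slitPlane)
    (hr : ∀ q ∈ Icc q₀ q₂, -((z - b q) / β) ∈ Complex.slitPlane) :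
    ∫ q in q₁..q₂, deriv b q / (z - b q) =
      Complex.log ((z - b q₁) / β) - Complex.log (-((z - b q₂) / β))
      - (Complex.log ((z - b q₀) / β) - Complex.log (-((z - b q₀) / β))) := by
  have hbd : ∀ q, HasDerivAt b (deriv b q) q := fun q =>
    (hb.differentiable one_ne_zero q).hasDerivAt
  have hb' : Continuous (deriv b) := hb.continuous_deriv le_rfl
  have hd : ∀ q, HasDerivAt (fun q => (z - b q) / β) (-deriv b q / β) q := fun q =>
    ((hbd q).const_sub z).div_const β
  have hne : ∀ q ∈ Icc q₁ q₂, z - b q ≠ 0 := by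
    intro q hq h0
    rcases le_total q q₀ with h | h
    · have := hl q ⟨hq.1, h⟩
      simp [h0] at this
    · have := hr q ⟨h, hq.2⟩
      simp [h0] at this
  have hcont : ContinuousOn (fun q => deriv b q / (z - b q)) (Icc q₁ q₂) :=
    hb'.continuousOn.div (continuousOn_const.sub hb.continuous.continuousOn) hne
  have hi1 : IntervalIntegrable (fun q => deriv b q / (z - b q)) volume q₁ q₀ :=
    (hcont.mono (by rw [uIcc_of_le h1]; exact Icc_subset_Icc_right h2)).intervalIntegrable
  have hi2 : IntervalIntegrable (fun q => deriv b q / (z - b q)) volume q₀ q₂ :=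
    (hcont.mono (by rw [uIcc_of_le h2]; exact Icc_subset_Icc_left h1)).intervalIntegrable
  rw [← intervalIntegral.integral_add_adjacent_intervals hi1 hi2]
  have I1 : ∫ q in q₁..q₀, deriv b q / (z - b q) =
      -Complex.log ((z - b q₀) / β) - -Complex.log ((z - b q₁) / β) := by
    refine intervalIntegral.integral_eq_sub_of_hasDerivAt (f := fun q => -Complex.log ((z - b q) / β))
      (fun q hq => ?_) hi1
    rw [uIcc_of_le h1] at hq
    have := ((hd q).clog_real (hl q hq)).neg
    refine this.congr_deriv ?_
    have := hne q ⟨hq.1, hq.2.trans h2⟩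
    field_simp
  have I2 : ∫ q in q₀..q₂, deriv b q / (z - b q) =
      -Complex.log (-((z - b q₂) / β)) - -Complex.log (-((z - b q₀) / β)) := by
    refine intervalIntegral.integral_eq_sub_of_hasDerivAt
      (f := fun q => -Complex.log (-((z - b q) / β))) (fun q hq => ?_) hi2
    rw [uIcc_of_le h2] at hq
    have := ((hd q).neg.clog_real (hr q hq)).neg
    refine this.congr_deriv ?_
    have := hne q ⟨h1.trans hq.1, hq.2⟩
    simp only [Pi.neg_apply]
    field_simp
  rw [I1, I2]; ring

/-- The Cauchy integral along a short arc of `b` jumps by `2πi` times the crossing sign when the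
pole moves along `a` across `b`. -/
theorem exists_tendsto_cauchy_jump (ha : HasDerivAt a α p₀) (hb : ContDiff ℝ 1 b)
    (hβ : deriv b q₀ = β) (hab : a p₀ = b q₀) (hx : ((starRingEnd ℂ) α * β).im ≠ 0) :
    ∃ δ > 0, (∀ p q, |p - p₀| < δ → |q - q₀| < δ → (p ≠ p₀ ∨ q ≠ q₀) → a p ≠ b q) ∧
      ∀ q₁ ∈ Ioo (q₀ - δ) q₀, ∀ q₂ ∈ Ioo q₀ (q₀ + δ),
        Tendsto (fun ε : ℝ => (∫ q in q₁..q₂, deriv b q / (a (p₀ + ε) - b q))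
            - ∫ q in q₁..q₂, deriv b q / (a (p₀ - ε) - b q)) (𝓝[>] 0)
          (𝓝 (2 * Real.pi * Complex.I *
            (SignType.sign ((starRingEnd ℂ) α * β).im : ℤ))) := by
  have hβ0 : β ≠ 0 := by rintro rfl; simp at hx
  have hσs : SignType.sign (α / β).im = - SignType.sign ((starRingEnd ℂ) α * β).im := by
    rw [im_div_eq, neg_div, Left.sign_neg, div_eq_mul_inv, sign_mul,
      sign_pos (inv_pos.2 (Complex.normSq_pos.2 hβ0)), mul_one]
  have hσ : (α / β).im ≠ 0 := by
    intro h
    rw [h, sign_zero] at hσs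
    have key : ∀ s : SignType, 0 = -s → s = 0 := by decide
    exact sign_ne_zero.2 hx (key _ hσs)
  have hbd : HasDerivAt b β q₀ := hβ ▸ (hb.differentiable one_ne_zero q₀).hasDerivAt
  obtain ⟨δ, hδ, H⟩ := exists_slitPlane_box ha hbd hab hβ0 hσ
  refine ⟨δ, hδ, fun p q hp hq hne he => ?_, fun q₁ h1 q₂ h2 => ?_⟩
  · have := H p q hp hq hne
    rcases le_total q q₀ with h | h
    · simpa [he] using this.1 h
    · simpa [he] using this.2 h
  have hq1 : |q₁ - q₀| < δ := by rw [abs_lt]; constructor <;> linarith [h1.1, h1.2]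
  have hq2 : |q₂ - q₀| < δ := by rw [abs_lt]; constructor <;> linarith [h2.1, h2.2]
  set I : ℝ → ℂ := fun p => ∫ q in q₁..q₂, deriv b q / (a p - b q) with hI
  set D : ℝ → ℂ := fun p =>
    Complex.log ((a p - b q₁) / β) - Complex.log (-((a p - b q₂) / β)) with hD
  have hDc : ContinuousAt D p₀ := by
    refine ContinuousAt.sub ?_ ?_
    · exact (((ha.continuousAt.sub continuousAt_const).div_const β)).clog
        ((H p₀ q₁ (by simpa) hq1 (Or.inr h1.2.ne)).1 h1.2.le)
    · exact (((ha.continuousAt.sub continuousAt_const).div_const β)).neg.clog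
        ((H p₀ q₂ (by simpa) hq2 (Or.inr h2.1.ne')).2 h2.1.le)
  have hsign := eventually_sign_im (f := fun p => (a p - b q₀) / β)
    ((ha.sub_const (b q₀)).div_const β) (by simp [hab]) hσ
  have hnear : ∀ᶠ p in 𝓝[≠] p₀, |p - p₀| < δ := by
    have : ∀ᶠ p in 𝓝 p₀, |p - p₀| < δ := Metric.ball_mem_nhds p₀ hδ
    exact this.filter_mono nhdsWithin_le_nhds
  -- `D` is continuous at `p₀`, while the mismatch of branches is `±πi` according to the side of `b`
  -- on which `a p` lies. Crossing over changes it by `2πi`.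
  have hform : ∀ᶠ p in 𝓝[≠] p₀, I p = D p + (SignType.sign (p - p₀) : ℤ) *
      (SignType.sign ((starRingEnd ℂ) α * β).im : ℤ) * (Real.pi * Complex.I) := by
    filter_upwards [hsign, hnear, self_mem_nhdsWithin] with p hs hp hne
    have hne' : p - p₀ ≠ 0 := sub_ne_zero.2 hne
    simp only [hI, hD]
    rw [integral_cauchy_eq_log hb hβ0 h1.2.le h2.1.le (q₀ := q₀), log_sub_log_neg, hs, hσs]
    · push_cast; ring
    · rw [← sign_ne_zero, hs]
      exact mul_ne_zero (sign_ne_zero.2 hne') (sign_ne_zero.2 hσ)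
    · intro q hq
      refine (H p q hp ?_ (Or.inl hne)).1 hq.2
      rw [abs_lt]; constructor <;> linarith [h1.1, hq.1, hq.2]
    · intro q hq
      refine (H p q hp ?_ (Or.inl hne)).2 hq.1
      rw [abs_lt]; constructor <;> linarith [h2.2, hq.1, hq.2]
  have tp : Tendsto (fun ε : ℝ => p₀ + ε) (𝓝[>] 0) (𝓝[≠] p₀) := by
    refine tendsto_nhdsWithin_iff.2 ⟨?_, ?_⟩
    · have : Continuous (fun ε : ℝ => p₀ + ε) := by fun_prop
      simpa using (this.tendsto 0).mono_left nhdsWithin_le_nhds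
    · filter_upwards [self_mem_nhdsWithin] with x hx
      simpa using (ne_of_gt hx)
  have tm : Tendsto (fun ε : ℝ => p₀ - ε) (𝓝[>] 0) (𝓝[≠] p₀) := by
    refine tendsto_nhdsWithin_iff.2 ⟨?_, ?_⟩
    · have : Continuous (fun ε : ℝ => p₀ - ε) := by fun_prop
      simpa using (this.tendsto 0).mono_left nhdsWithin_le_nhds
    · filter_upwards [self_mem_nhdsWithin] with x hx
      simpa using (ne_of_gt hx)
  have hlim : Tendsto (fun ε : ℝ => D (p₀ + ε) - D (p₀ - ε) + 2 * Real.pi * Complex.I *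
      (SignType.sign ((starRingEnd ℂ) α * β).im : ℤ)) (𝓝[>] 0)
      (𝓝 (D p₀ - D p₀ + 2 * Real.pi * Complex.I *
        (SignType.sign ((starRingEnd ℂ) α * β).im : ℤ))) :=
    ((hDc.tendsto.comp (tp.mono_right nhdsWithin_le_nhds)).sub
      (hDc.tendsto.comp (tm.mono_right nhdsWithin_le_nhds))).add_const _
  rw [sub_self, zero_add] at hlim
  refine hlim.congr' ?_
  filter_upwards [tp.eventually hform, tm.eventually hform, self_mem_nhdsWithin] with ε e1 e2 hε
  have hε' : (0 : ℝ) < ε := hε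
  have s1 : SignType.sign (p₀ + ε - p₀) = 1 := by rw [add_sub_cancel_left]; exact sign_pos hε'
  have s2 : SignType.sign (p₀ - ε - p₀) = -1 := by
    rw [sub_sub_cancel_left]; exact sign_neg (by linarith)
  rw [s1] at e1
  rw [s2] at e2
  simp only [hI] at e1 e2
  rw [e1, e2]
  simp only [SignType.coe_neg, SignType.coe_one]
  push_cast; ring

/-! ### Bilinear relation on the elliptic curve `y ^ 2 = x ^ 3 + c₂ x ^ 2 + c₁ x + c₀` -/

/-- A closed `C¹` loop on the affine curve `y ^ 2 = x ^ 3 + c₂ x ^ 2 + c₁ x + c₀` avoiding `y = 0`. -/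
structure CubicLoop (c₂ c₁ c₀ : ℂ) where
  x : ℝ → ℂ
  y : ℝ → ℂ
  contDiff_x : ContDiff ℝ 1 x
  continuous_y : Continuous y
  periodic_x : Function.Periodic x 1
  periodic_y : Function.Periodic y 1
  sq_y : ∀ t, y t ^ 2 = x t ^ 3 + c₂ * x t ^ 2 + c₁ * x t + c₀
  y_ne_zero : ∀ t, y t ≠ 0

/-- The slope of the chord through `(x, y)` and `(t, -s)`. -/
def chordSlope (c₂ c₁ x y t s : ℂ) : ℂ :=
  if y = s then (y + s) / (x - t) else (x ^ 2 + x * t + t ^ 2 + c₂ * (x + t) + c₁) / (y - s)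

theorem chordSlope_swap (c₂ c₁ x y t s : ℂ) :
    chordSlope c₂ c₁ t s x y = - chordSlope c₂ c₁ x y t s := by
  unfold chordSlope
  by_cases h : y = s
  · rw [if_pos h, if_pos h.symm, ← neg_sub x t, div_neg, add_comm]
  · rw [if_neg h, if_neg (Ne.symm h), ← neg_sub y s, div_neg]; ring

/-- Subtracting the curve equations gives `(y - s)(y + s) = (x - t)(x² + xt + t² + c₂(x + t) + c₁)`.
The second form is regular at `x = t` when `y ≠ s`, so the slope is singular only where the two
points coincide. -/
theorem chordSlope_of_ne {c₂ c₁ c₀ x y t s : ℂ} (hy : y ^ 2 = x ^ 3 + c₂ * x ^ 2 + c₁ * x + c₀)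
    (hs : s ^ 2 = t ^ 3 + c₂ * t ^ 2 + c₁ * t + c₀) (h : x ≠ t) :
    chordSlope c₂ c₁ x y t s = (y + s) / (x - t) := by
  unfold chordSlope
  split_ifs with h1
  · rfl
  · rw [div_eq_div_iff (sub_ne_zero.2 h1) (sub_ne_zero.2 h)]
    linear_combination hs - hy

namespace CubicLoop

variable {c₂ c₁ c₀ : ℂ} (A B : CubicLoop c₂ c₁ c₀)

theorem hasDerivAt_x (t : ℝ) : HasDerivAt A.x (deriv A.x t) t :=
  (A.contDiff_x.differentiable one_ne_zero t).hasDerivAt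

theorem continuous_x : Continuous A.x := A.contDiff_x.continuous

theorem continuous_deriv_x : Continuous (deriv A.x) := A.contDiff_x.continuous_deriv le_rfl

theorem periodic_deriv_x : Function.Periodic (deriv A.x) 1 := fun t => by
  have h : (fun s => A.x (s + 1)) = A.x := funext A.periodic_x
  rw [← deriv_comp_add_const A.x 1 t, h]

theorem hasDerivAt_y (t : ℝ) :
    HasDerivAt A.y ((3 * A.x t ^ 2 + 2 * c₂ * A.x t + c₁) * deriv A.x t / (2 * A.y t)) t := by
  refine hasDerivAt_of_sq_eq A.continuous_y.continuousAt (A.y_ne_zero t) A.sq_y ?_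
  have h := A.hasDerivAt_x t
  refine ((((h.pow 3).add ((h.pow 2).const_mul c₂)).add (h.const_mul c₁)).add_const c₀).congr_deriv ?_
  push_cast; ring

/-- The two loops pass through the same point at the times `p` and `q`. -/
def Meets (p q : ℝ) : Prop := A.x p = B.x q ∧ A.y p = B.y q

theorem isOpen_not_meets : IsOpen {z : ℝ × ℝ | ¬ A.Meets B z.1 z.2} := by
  have hx1 := A.continuous_x
  have hx2 := B.continuous_x
  have hy1 := A.continuous_y
  have hy2 := B.continuous_y
  rw [← isClosed_compl_iff]
  have : {z : ℝ × ℝ | ¬ A.Meets B z.1 z.2}ᶜ =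
      {z | A.x z.1 = B.x z.2} ∩ {z | A.y z.1 = B.y z.2} := by
    ext z; simp [Meets]
  rw [this]
  exact (isClosed_eq (by fun_prop) (by fun_prop)).inter (isClosed_eq (by fun_prop) (by fun_prop))

/-- The chord slope between the two loops. -/
def slope (p q : ℝ) : ℂ := chordSlope c₂ c₁ (A.x p) (A.y p) (B.x q) (B.y q)

theorem slope_swap (p q : ℝ) : B.slope A q p = - A.slope B p q := chordSlope_swap _ _ _ _ _ _

theorem slope_of_x_ne {p q : ℝ} (h : A.x p ≠ B.x q) :
    A.slope B p q = (A.y p + B.y q) / (A.x p - B.x q) :=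
  chordSlope_of_ne (A.sq_y p) (B.sq_y q) h

theorem slope_of_y_ne {p q : ℝ} (h : A.y p ≠ B.y q) :
    A.slope B p q = (A.x p ^ 2 + A.x p * B.x q + B.x q ^ 2 + c₂ * (A.x p + B.x q) + c₁) /
      (A.y p - B.y q) := if_neg h

theorem slope_periodic_right (p : ℝ) : Function.Periodic (A.slope B p) 1 := fun q => by
  simp only [slope, B.periodic_x q, B.periodic_y q]

theorem slope_periodic_left (p q : ℝ) : A.slope B (p + 1) q = A.slope B p q := by
  simp only [slope, A.periodic_x p, A.periodic_y p]

theorem continuousAt_slope {z : ℝ × ℝ} (h : ¬ A.Meets B z.1 z.2) :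
    ContinuousAt (fun z : ℝ × ℝ => A.slope B z.1 z.2) z := by
  have hx1 : ContinuousAt (fun z : ℝ × ℝ => A.x z.1) z := (A.continuous_x.comp continuous_fst).continuousAt
  have hx2 : ContinuousAt (fun z : ℝ × ℝ => B.x z.2) z := (B.continuous_x.comp continuous_snd).continuousAt
  have hy1 : ContinuousAt (fun z : ℝ × ℝ => A.y z.1) z := (A.continuous_y.comp continuous_fst).continuousAt
  have hy2 : ContinuousAt (fun z : ℝ × ℝ => B.y z.2) z := (B.continuous_y.comp continuous_snd).continuousAt
  by_cases hx : A.x z.1 = B.x z.2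
  · have hy : A.y z.1 ≠ B.y z.2 := fun hy => h ⟨hx, hy⟩
    have hev : ∀ᶠ w : ℝ × ℝ in 𝓝 z, A.y w.1 ≠ B.y w.2 := by
      filter_upwards [(hy1.sub hy2).eventually_ne (sub_ne_zero.2 hy)] with w hw using sub_ne_zero.1 hw
    refine ContinuousAt.congr ?_ (hev.mono fun w hw => (A.slope_of_y_ne B hw).symm)
    have := sub_ne_zero.2 hy
    fun_prop (disch := assumption)
  · have hev : ∀ᶠ w : ℝ × ℝ in 𝓝 z, A.x w.1 ≠ B.x w.2 := by
      filter_upwards [(hx1.sub hx2).eventually_ne (sub_ne_zero.2 hx)] with w hw using sub_ne_zero.1 hw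
    refine ContinuousAt.congr ?_ (hev.mono fun w hw => (A.slope_of_x_ne B hw).symm)
    have := sub_ne_zero.2 hx
    fun_prop (disch := assumption)

/-- If `m` is the slope and `x₃` the third abscissa on the chord, then `m² = x + t + x₃ + c₂`, so
the last factor is `x - x₃`. This is the derivative of `ζ(u - v) - ζ(u) + ζ(v)` in algebraic form.
-/
theorem hasDerivAt_slope_left {p q : ℝ} (h : ¬ A.Meets B p q) :
    HasDerivAt (fun p => A.slope B p q)
      (deriv A.x p / (2 * A.y p) * (2 * A.x p + B.x q + c₂ - A.slope B p q ^ 2)) p := by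
  have hx := A.hasDerivAt_x p
  have hy := A.hasDerivAt_y p
  have h0 := A.y_ne_zero p
  have e1 := A.sq_y p
  have e2 := B.sq_y q
  by_cases hxe : A.x p = B.x q
  · have hye : A.y p ≠ B.y q := fun hy => h ⟨hxe, hy⟩
    have hev : ∀ᶠ w in 𝓝 p, A.y w ≠ B.y q :=
      A.continuous_y.continuousAt.eventually_ne hye
    have hne := sub_ne_zero.2 hye
    have hd := ((((hx.pow 2).add (hx.mul_const (B.x q))).add_const (B.x q ^ 2)).add
      ((hx.add_const (B.x q)).const_mul c₂)).add_const c₁ |>.div (hy.sub_const (B.y q)) hne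
    refine (hd.congr_deriv ?_).congr_of_eventuallyEq (hev.mono fun w hw => A.slope_of_y_ne B hw)
    rw [A.slope_of_y_ne B hye]
    simp only [Pi.add_apply, Pi.pow_apply]
    field_simp
    push_cast
    linear_combination deriv A.x p * (2 * A.x p + B.x q + c₂) * (e1 - e2)
  · have hev : ∀ᶠ w in 𝓝 p, A.x w ≠ B.x q :=
      A.continuous_x.continuousAt.eventually_ne hxe
    have hne := sub_ne_zero.2 hxe
    have hd := (hy.add_const (B.y q)).div (hx.sub_const (B.x q)) hne
    refine (hd.congr_deriv ?_).congr_of_eventuallyEq (hev.mono fun w hw => A.slope_of_x_ne B hw)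
    rw [A.slope_of_x_ne B hxe]
    field_simp
    linear_combination deriv A.x p * (e2 - e1)

theorem hasDerivAt_slope_right {p q : ℝ} (h : ¬ A.Meets B p q) :
    HasDerivAt (A.slope B p)
      (-(deriv B.x q / (2 * B.y q) * (2 * B.x q + A.x p + c₂ - A.slope B p q ^ 2))) q := by
  have h' : ¬ B.Meets A q p := fun hm => h ⟨hm.1.symm, hm.2.symm⟩
  have := (B.hasDerivAt_slope_left A h').neg
  rw [slope_swap, neg_sq] at this
  refine this.congr_of_eventuallyEq (Eventually.of_forall fun w => ?_)
  simp [slope_swap A B]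

/-- The period of `dx / y`. -/
def periodFirst : ℂ := ∫ t in (0 : ℝ)..1, deriv A.x t / A.y t

/-- The period of `x dx / y`. -/
def periodSecond : ℂ := ∫ t in (0 : ℝ)..1, A.x t * (deriv A.x t / A.y t)

theorem continuous_form : Continuous (fun t => deriv A.x t / A.y t) :=
  A.continuous_deriv_x.div A.continuous_y A.y_ne_zero

/-- The integrand of the integral of the third kind `∮_B (y + s) / (x - t) dt / s`. -/
def kernel (p q : ℝ) : ℂ := A.slope B p q * (deriv B.x q / B.y q)

def thirdKind (p : ℝ) : ℂ := ∫ q in (0 : ℝ)..1, A.kernel B p q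

theorem kernel_periodic_right (p : ℝ) : Function.Periodic (A.kernel B p) 1 := fun q => by
  simp only [kernel, A.slope_periodic_right B p q, B.periodic_deriv_x q, B.periodic_y q]

theorem thirdKind_periodic : Function.Periodic (A.thirdKind B) 1 := fun p => by
  simp only [thirdKind, kernel, slope_periodic_left]

theorem continuousAt_kernel {z : ℝ × ℝ} (h : ¬ A.Meets B z.1 z.2) :
    ContinuousAt (Function.uncurry (A.kernel B)) z :=
  (A.continuousAt_slope B h).mul (B.continuous_form.comp continuous_snd).continuousAt

theorem eventually_not_meets {z : ℝ × ℝ} (h : ¬ A.Meets B z.1 z.2) :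
    ∀ᶠ w : ℝ × ℝ in 𝓝 z, ¬ A.Meets B w.1 w.2 := (A.isOpen_not_meets B).mem_nhds h

/-- Write `x - x₃ = (x - t) + (t - x₃)`, with `x₃` the third abscissa on the chord. The part `(t -
x₃) dt/s` is `-2` times the differential of the slope along `B`, hence exact; `(x - t) dt/s` yields
the two periods of `B`. -/
theorem hasDerivAt_thirdKind {p : ℝ} (h : ∀ q, ¬ A.Meets B p q) :
    HasDerivAt (A.thirdKind B)
      (deriv A.x p / A.y p / 2 * (A.x p * B.periodFirst - B.periodSecond)) p := by
  have hev : ∀ q, ∀ᶠ z : ℝ × ℝ in 𝓝 (p, q), ¬ A.Meets B z.1 z.2 :=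
    fun q => A.eventually_not_meets B (h q)
  set F' : ℝ → ℝ → ℂ := fun p q => deriv A.x p / (2 * A.y p) *
    (2 * A.x p + B.x q + c₂ - A.slope B p q ^ 2) * (deriv B.x q / B.y q) with hF'
  have hc : ∀ z : ℝ × ℝ, ¬ A.Meets B z.1 z.2 → ContinuousAt (Function.uncurry F') z := by
    intro z hz
    have h1 := A.continuousAt_slope B hz
    have h2 : ContinuousAt (fun z : ℝ × ℝ => deriv A.x z.1 / (2 * A.y z.1)) z :=
      ((A.continuous_deriv_x.div (A.continuous_y.const_mul 2) fun t =>
        mul_ne_zero two_ne_zero (A.y_ne_zero t)).comp continuous_fst).continuousAt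
    have h3 : ContinuousAt (fun z : ℝ × ℝ => deriv B.x z.2 / B.y z.2) z :=
      (B.continuous_form.comp continuous_snd).continuousAt
    have h4 : ContinuousAt (fun z : ℝ × ℝ => A.x z.1) z := (A.continuous_x.comp continuous_fst).continuousAt
    have h5 : ContinuousAt (fun z : ℝ × ℝ => B.x z.2) z := (B.continuous_x.comp continuous_snd).continuousAt
    exact (h2.mul ((((h4.const_mul 2).add h5).add_const c₂).sub (h1.pow 2))).mul h3
  have hd := hasDerivAt_parametric_integral (a := 0) (b := 1) (F := A.kernel B) (F' := F') (x₀ := p)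
    (fun t _ => (hev t).mono fun z hz => A.continuousAt_kernel B hz)
    (fun t _ => (hev t).mono fun z hz => hc z hz)
    (fun t _ => (hev t).mono fun z hz => (A.hasDerivAt_slope_left B hz).mul_const _)
  refine hd.congr_deriv ?_
  have hs : Continuous (A.slope B p) := continuous_iff_continuousAt.2 fun q =>
    (A.hasDerivAt_slope_right B (h q)).continuousAt
  have hB := B.continuous_form
  have hBx := B.continuous_x
  have key : ∫ q in (0 : ℝ)..1, (2 * B.x q + A.x p + c₂ - A.slope B p q ^ 2) *
      (deriv B.x q / B.y q) = 0 := by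
    have h1 := intervalIntegral.integral_eq_sub_of_hasDerivAt (a := 0) (b := 1)
      (f := fun q => -2 * A.slope B p q)
      (f' := fun q => (2 * B.x q + A.x p + c₂ - A.slope B p q ^ 2) * (deriv B.x q / B.y q))
      (fun q _ => ((A.hasDerivAt_slope_right B (h q)).const_mul (-2)).congr_deriv (by
        have := B.y_ne_zero q
        field_simp)) (Continuous.intervalIntegrable (by fun_prop) _ _)
    rw [h1]
    have := A.slope_periodic_right B p 0
    rw [zero_add] at this
    rw [this, sub_self]
  have hsplit : ∀ q, F' p q = deriv A.x p / A.y p / 2 * (A.x p * (deriv B.x q / B.y q)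
      - B.x q * (deriv B.x q / B.y q)
      + (2 * B.x q + A.x p + c₂ - A.slope B p q ^ 2) * (deriv B.x q / B.y q)) := fun q => by
    have := A.y_ne_zero p
    have := B.y_ne_zero q
    simp only [hF']
    field_simp
    ring
  simp only [hsplit]
  rw [intervalIntegral.integral_const_mul, intervalIntegral.integral_add, key, add_zero,
    intervalIntegral.integral_sub, intervalIntegral.integral_const_mul]
  · rfl
  all_goals exact Continuous.intervalIntegrable (by fun_prop) _ _

end CubicLoop
-- Jumps of the third-kind integral at the meeting times, and the bilinear relation.
theorem tendsto_const_add_nhdsGT (p₀ : ℝ) : Tendsto (fun ε : ℝ => p₀ + ε) (𝓝[>] 0) (𝓝[>] p₀) := by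
  refine tendsto_nhdsWithin_iff.2 ⟨?_, ?_⟩
  · have : Continuous (fun ε : ℝ => p₀ + ε) := by fun_prop
    simpa using (this.tendsto 0).mono_left nhdsWithin_le_nhds
  · filter_upwards [self_mem_nhdsWithin] with x hx
    simpa using hx

theorem tendsto_const_sub_nhdsLT (p₀ : ℝ) : Tendsto (fun ε : ℝ => p₀ - ε) (𝓝[>] 0) (𝓝[<] p₀) := by
  refine tendsto_nhdsWithin_iff.2 ⟨?_, ?_⟩
  · have : Continuous (fun ε : ℝ => p₀ - ε) := by fun_prop
    simpa using (this.tendsto 0).mono_left nhdsWithin_le_nhds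
  · filter_upwards [self_mem_nhdsWithin] with x hx
    simpa using hx

theorem eventually_fract_ne (x s : ℝ) : ∀ᶠ y in 𝓝[≠] x, Int.fract y ≠ s := by
  have h : ∀ᶠ y in 𝓝[≠] x, y - s ∉ range ((↑) : ℤ → ℝ) := by
    by_cases hx : x - s ∈ range ((↑) : ℤ → ℝ)
    · obtain ⟨n, hn⟩ := hx
      have h1 : ∀ᶠ y in 𝓝[≠] x, |y - x| < 1 :=
        Eventually.filter_mono nhdsWithin_le_nhds (Metric.ball_mem_nhds x one_pos)
      filter_upwards [h1, self_mem_nhdsWithin] with y hy hne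
      rintro ⟨m, hm⟩
      have : y - x = ((m - n : ℤ) : ℝ) := by push_cast; linarith
      rw [this, ← Int.cast_abs, ← Int.cast_one, Int.cast_lt, Int.abs_lt_one_iff] at hy
      rw [hy, Int.cast_zero, sub_eq_zero] at this
      exact hne this
    · have hc : IsClosed (range ((↑) : ℤ → ℝ)) := Int.isClosedEmbedding_coe_real.isClosed_range
      have h1 : ∀ᶠ y in 𝓝 x, y - s ∈ (range ((↑) : ℤ → ℝ))ᶜ :=
        (continuous_id.sub continuous_const).continuousAt.eventually (hc.isOpen_compl.mem_nhds hx)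
      exact h1.filter_mono nhdsWithin_le_nhds
  filter_upwards [h] with y hy he
  exact hy ⟨⌊y⌋, by rw [← he, Int.self_sub_fract]⟩

namespace CubicLoop

variable {c₂ c₁ c₀ : ℂ} (A B : CubicLoop c₂ c₁ c₀)

/-- The oriented area spanned by the velocities. -/
def area (p q : ℝ) : ℝ := ((starRingEnd ℂ) (deriv A.x p) * deriv B.x q).im

open Classical in
/-- The jump at `p` of the integral of the third kind caused by the time `q`. -/
def jump (p q : ℝ) : ℂ :=
  if A.Meets B p q then 4 * Real.pi * Complex.I * (SignType.sign (A.area B p q) : ℤ) else 0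

theorem tendsto_sub_of_continuousAt {G : ℝ → ℂ} {p₀ : ℝ} (h : ContinuousAt G p₀) :
    Tendsto (fun ε : ℝ => G (p₀ + ε) - G (p₀ - ε)) (𝓝[>] 0) (𝓝 0) := by
  have := (h.tendsto.comp ((tendsto_const_add_nhdsGT p₀).mono_right nhdsWithin_le_nhds)).sub
    (h.tendsto.comp ((tendsto_const_sub_nhdsLT p₀).mono_right nhdsWithin_le_nhds))
  rwa [sub_self] at this

theorem eventually_Ioo_prod {q₀ δ : ℝ} (hδ : 0 < δ) :
    ∀ᶠ z in 𝓝[<] q₀ ×ˢ 𝓝[>] q₀, z.1 ∈ Ioo (q₀ - δ) q₀ ∧ z.2 ∈ Ioo q₀ (q₀ + δ) :=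
  Eventually.prod_mk (Ioo_mem_nhdsLT (by linarith)) (Ioo_mem_nhdsGT (by linarith))

theorem exists_box {P : ℝ × ℝ → Prop} {p₀ q₀ : ℝ} (h : ∀ᶠ z in 𝓝 (p₀, q₀), P z) :
    ∃ δ > 0, ∀ p q, |p - p₀| < δ → |q - q₀| < δ → P (p, q) := by
  obtain ⟨δ, hδ, H⟩ := Metric.eventually_nhds_iff.1 h
  refine ⟨δ, hδ, fun p q hp hq => H ?_⟩
  rw [Prod.dist_eq, Real.dist_eq, Real.dist_eq]
  exact max_lt hp hq

/-- The part of the kernel that is regular at points where the loops meet. -/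
def regularKernel (p q : ℝ) : ℂ :=
  (A.x p ^ 2 + A.x p * B.x q + B.x q ^ 2 + c₂ * (A.x p + B.x q) + c₁) / (A.y p + B.y q) *
    (deriv B.x q / B.y q)

/-- Split `(y + s)/s = 2 + (y - s)/s`. In the second term the factor `x - t` cancels by the curve
equations, at the cost of a denominator `y + s`. The coefficient `2` turns the Cauchy jump `2πi`
into `4πi`. -/
theorem kernel_eq {p q : ℝ} (hx : A.x p ≠ B.x q) (hy : A.y p + B.y q ≠ 0) :
    A.kernel B p q = 2 * (deriv B.x q / (A.x p - B.x q)) + A.regularKernel B p q := by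
  have h1 := sub_ne_zero.2 hx
  have h2 := B.y_ne_zero q
  rw [kernel, A.slope_of_x_ne B hx, regularKernel]
  field_simp
  linear_combination deriv B.x q * (A.sq_y p - B.sq_y q)

theorem continuousAt_regularKernel {z : ℝ × ℝ} (h : A.y z.1 + B.y z.2 ≠ 0) :
    ContinuousAt (Function.uncurry (A.regularKernel B)) z := by
  have hx1 : ContinuousAt (fun z : ℝ × ℝ => A.x z.1) z := (A.continuous_x.comp continuous_fst).continuousAt
  have hx2 : ContinuousAt (fun z : ℝ × ℝ => B.x z.2) z := (B.continuous_x.comp continuous_snd).continuousAt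
  have hy1 : ContinuousAt (fun z : ℝ × ℝ => A.y z.1) z := (A.continuous_y.comp continuous_fst).continuousAt
  have hy2 : ContinuousAt (fun z : ℝ × ℝ => B.y z.2) z := (B.continuous_y.comp continuous_snd).continuousAt
  have h3 : ContinuousAt (fun z : ℝ × ℝ => deriv B.x z.2 / B.y z.2) z :=
    (B.continuous_form.comp continuous_snd).continuousAt
  have hn : ContinuousAt (fun z : ℝ × ℝ => A.x z.1 ^ 2 + A.x z.1 * B.x z.2 + B.x z.2 ^ 2 +
    c₂ * (A.x z.1 + B.x z.2) + c₁) z := by fun_prop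
  exact (hn.div (hy1.add hy2) h).mul h3

theorem eventually_tendsto_jump (p₀ q₀ : ℝ) (htr : A.Meets B p₀ q₀ → A.area B p₀ q₀ ≠ 0) :
    ∀ᶠ z in 𝓝[<] q₀ ×ˢ 𝓝[>] q₀, Tendsto (fun ε : ℝ => (∫ q in z.1..z.2, A.kernel B (p₀ + ε) q)
      - ∫ q in z.1..z.2, A.kernel B (p₀ - ε) q) (𝓝[>] 0) (𝓝 (A.jump B p₀ q₀)) := by
  by_cases hm : A.Meets B p₀ q₀
  · have hy0 : A.y p₀ + B.y q₀ ≠ 0 := by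
      rw [hm.2, ← two_mul]; exact mul_ne_zero two_ne_zero (B.y_ne_zero q₀)
    have hyc : Continuous (fun z : ℝ × ℝ => A.y z.1 + B.y z.2) :=
      (A.continuous_y.comp continuous_fst).add (B.continuous_y.comp continuous_snd)
    obtain ⟨δ₁, hδ₁, H₁⟩ := exists_box
      ((hyc.continuousAt (x := (p₀, q₀))).eventually_ne hy0)
    obtain ⟨δ₂, hδ₂, hne, H₂⟩ := exists_tendsto_cauchy_jump (A.hasDerivAt_x p₀) B.contDiff_x
      rfl hm.1 (htr hm)
    set δ := min δ₁ δ₂ with hδ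
    have hδ0 : 0 < δ := lt_min hδ₁ hδ₂
    filter_upwards [eventually_Ioo_prod (q₀ := q₀) hδ0] with z hz
    obtain ⟨⟨ha1, ha2⟩, hb1, hb2⟩ := hz
    have hd1 : δ ≤ δ₁ := min_le_left _ _
    have hd2 : δ ≤ δ₂ := min_le_right _ _
    have hle : z.1 ≤ z.2 := by linarith
    have hq : ∀ q ∈ uIcc z.1 z.2, |q - q₀| < δ := fun q hq => by
      rw [uIcc_of_le hle] at hq
      rw [abs_lt]; constructor <;> linarith [hq.1, hq.2]
    have hform : ∀ᶠ p in 𝓝[≠] p₀, ∫ q in z.1..z.2, A.kernel B p q =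
        2 * (∫ q in z.1..z.2, deriv B.x q / (A.x p - B.x q))
          + ∫ q in z.1..z.2, A.regularKernel B p q := by
      have hnear : ∀ᶠ p in 𝓝[≠] p₀, |p - p₀| < δ :=
        Eventually.filter_mono nhdsWithin_le_nhds (Metric.ball_mem_nhds p₀ hδ0)
      filter_upwards [hnear, self_mem_nhdsWithin] with p hp hpne
      have hx : ∀ q ∈ uIcc z.1 z.2, A.x p ≠ B.x q := fun q h =>
        hne p q (hp.trans_le hd2) ((hq q h).trans_le hd2) (Or.inl hpne)
      have hy : ∀ q ∈ uIcc z.1 z.2, A.y p + B.y q ≠ 0 := fun q h =>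
        H₁ p q (hp.trans_le hd1) ((hq q h).trans_le hd1)
      rw [← intervalIntegral.integral_const_mul, ← intervalIntegral.integral_add]
      · exact intervalIntegral.integral_congr fun q h => A.kernel_eq B (hx q h) (hy q h)
      · refine ContinuousOn.intervalIntegrable ?_
        exact continuousOn_const.mul (B.continuous_deriv_x.continuousOn.div
          (continuousOn_const.sub B.continuous_x.continuousOn) fun q h => sub_ne_zero.2 (hx q h))
      · refine ContinuousOn.intervalIntegrable (continuousOn_slice fun q h => ?_)
        exact A.continuousAt_regularKernel B (hy q h)
    have hreg : ContinuousAt (fun p => ∫ q in z.1..z.2, A.regularKernel B p q) p₀ := by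
      refine continuousAt_parametric_integral fun q h => ?_
      have h0 : A.y p₀ + B.y q ≠ 0 := H₁ p₀ q (by simpa) ((hq q h).trans_le hd1)
      filter_upwards [(hyc.continuousAt (x := (p₀, q))).eventually_ne h0] with w hw
      exact A.continuousAt_regularKernel B hw
    have hJ := ((H₂ z.1 ⟨by linarith, ha2⟩ z.2 ⟨hb1, by linarith⟩).const_mul 2).add
      (tendsto_sub_of_continuousAt hreg)
    have hval : A.jump B p₀ q₀ = 2 * (2 * Real.pi * Complex.I * (SignType.sign
        ((starRingEnd ℂ) (deriv A.x p₀) * deriv B.x q₀).im : ℤ)) + 0 := by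
      rw [jump, if_pos hm, area]; ring
    rw [hval]
    refine hJ.congr' ?_
    have hp := ((tendsto_const_add_nhdsGT p₀).mono_right (nhdsWithin_mono p₀ fun x hx => ne_of_gt hx)).eventually hform
    have hm' := ((tendsto_const_sub_nhdsLT p₀).mono_right (nhdsWithin_mono p₀ fun x hx => ne_of_lt hx)).eventually hform
    filter_upwards [hp, hm'] with ε e1 e2
    rw [e1, e2]; ring
  · obtain ⟨δ, hδ, H⟩ := exists_box (A.eventually_not_meets B (z := (p₀, q₀)) hm)
    filter_upwards [eventually_Ioo_prod (q₀ := q₀) hδ] with z hz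
    obtain ⟨⟨ha1, ha2⟩, hb1, hb2⟩ := hz
    rw [jump, if_neg hm]
    refine tendsto_sub_of_continuousAt (G := fun p => ∫ q in z.1..z.2, A.kernel B p q)
      (continuousAt_parametric_integral fun q hq => ?_)
    rw [uIcc_of_le (by linarith)] at hq
    have : ¬ A.Meets B p₀ q := H p₀ q (by simpa) (by
      rw [abs_lt]; constructor <;> linarith [hq.1, hq.2])
    filter_upwards [A.eventually_not_meets B (z := (p₀, q)) this] with w hw
    exact A.continuousAt_kernel B hw

theorem meets_add_one_left (p q : ℝ) : A.Meets B (p + 1) q ↔ A.Meets B p q := by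
  simp only [Meets, A.periodic_x p, A.periodic_y p]

theorem meets_add_one_right (p q : ℝ) : A.Meets B p (q + 1) ↔ A.Meets B p q := by
  simp only [Meets, B.periodic_x q, B.periodic_y q]

theorem meets_fract (p q : ℝ) : A.Meets B (Int.fract p) (Int.fract q) ↔ A.Meets B p q := by
  have h : ∀ {f : ℝ → ℂ}, Function.Periodic f 1 → ∀ t, f (Int.fract t) = f t := fun hf t => by
    have := hf.sub_zsmul_eq (x := t) ⌊t⌋
    rwa [zsmul_eq_mul, mul_one] at this
  simp only [Meets, h A.periodic_x, h A.periodic_y, h B.periodic_x, h B.periodic_y]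

open Classical in
theorem jump_periodic_left (q : ℝ) : Function.Periodic (fun p => A.jump B p q) 1 := fun p => by
  simp only [jump, area, A.periodic_deriv_x p]
  exact if_congr (A.meets_add_one_left B p q) rfl rfl

open Classical in
theorem jump_periodic_right (p : ℝ) : Function.Periodic (A.jump B p) 1 := fun q => by
  simp only [jump, area, B.periodic_deriv_x q]
  exact if_congr (A.meets_add_one_right B p q) rfl rfl

/-- The meeting times in a fundamental square. -/
def meetings : Set (ℝ × ℝ) := {z | z.1 ∈ Ico (0 : ℝ) 1 ∧ z.2 ∈ Ico (0 : ℝ) 1 ∧ A.Meets B z.1 z.2}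

theorem fract_mem_meetings {p q : ℝ} (h : A.Meets B p q) :
    (Int.fract p, Int.fract q) ∈ A.meetings B :=
  ⟨⟨Int.fract_nonneg p, Int.fract_lt_one p⟩, ⟨Int.fract_nonneg q, Int.fract_lt_one q⟩,
    (A.meets_fract B p q).2 h⟩

theorem meets_of_jump_ne_zero {p q : ℝ} (h : A.jump B p q ≠ 0) : A.Meets B p q := by
  by_contra hm
  exact h (if_neg hm)

variable {A B}

theorem area_fract (p q : ℝ) : A.area B (Int.fract p) (Int.fract q) = A.area B p q := by
  have h : ∀ {f : ℝ → ℂ}, Function.Periodic f 1 → ∀ t, f (Int.fract t) = f t := fun hf t => by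
    have := hf.sub_zsmul_eq (x := t) ⌊t⌋
    rwa [zsmul_eq_mul, mul_one] at this
  simp only [area, h A.periodic_deriv_x, h B.periodic_deriv_x]

theorem eventually_not_meets_slice (hfin : (A.meetings B).Finite) (p₀ : ℝ) :
    ∀ᶠ p in 𝓝[≠] p₀, ∀ q, ¬ A.Meets B p q := by
  have h : ∀ᶠ p in 𝓝[≠] p₀, ∀ z ∈ A.meetings B, Int.fract p ≠ z.1 :=
    (eventually_all_finite hfin).2 fun z _ => eventually_fract_ne p₀ z.1
  filter_upwards [h] with p hp q hm
  exact hp _ (A.fract_mem_meetings B hm) rfl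

theorem continuous_kernel_of_not_meets {p : ℝ} (h : ∀ q, ¬ A.Meets B p q) :
    Continuous (A.kernel B p) := continuous_iff_continuousAt.2 fun q =>
  ContinuousAt.comp (f := fun t => (p, t)) (A.continuousAt_kernel B (z := (p, q)) (h q))
    (by fun_prop)

/-- The jump is defined for arcs of `B` as a limit of differences at `p₀ ± ε`. It is additive in
arcs because the kernel is continuous in `q` at those nearby times, and short arcs are understood,
so `sum_jumps` gives the whole loop. -/
theorem tendsto_thirdKind_jump (hfin : (A.meetings B).Finite)
    (htr : ∀ z ∈ A.meetings B, A.area B z.1 z.2 ≠ 0) (p₀ : ℝ) :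
    Tendsto (fun ε : ℝ => A.thirdKind B (p₀ + ε) - A.thirdKind B (p₀ - ε)) (𝓝[>] 0)
      (𝓝 (∑ q ∈ hfin.toFinset.image Prod.snd, A.jump B p₀ q)) := by
  have htr' : ∀ p q, A.Meets B p q → A.area B p q ≠ 0 := fun p q hm => by
    rw [← area_fract]; exact htr _ (A.fract_mem_meetings B hm)
  have hcont : ∀ᶠ ε in 𝓝[>] (0 : ℝ), Continuous (A.kernel B (p₀ + ε)) ∧
      Continuous (A.kernel B (p₀ - ε)) := by
    have h := eventually_not_meets_slice hfin p₀
    filter_upwards [((tendsto_const_add_nhdsGT p₀).mono_right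
      (nhdsWithin_mono p₀ fun x hx => ne_of_gt hx)).eventually h,
      ((tendsto_const_sub_nhdsLT p₀).mono_right
      (nhdsWithin_mono p₀ fun x hx => ne_of_lt hx)).eventually h] with ε h1 h2
    exact ⟨continuous_kernel_of_not_meets h1, continuous_kernel_of_not_meets h2⟩
  obtain ⟨c, hc⟩ := sum_jumps
    (V := fun q q' c => Tendsto (fun ε : ℝ => (∫ t in q..q', A.kernel B (p₀ + ε) t)
      - ∫ t in q..q', A.kernel B (p₀ - ε) t) (𝓝[>] 0) (𝓝 c))
    (fun x y z c d h h' => (h.add h').congr' (by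
      filter_upwards [hcont] with ε hε
      rw [← intervalIntegral.integral_add_adjacent_intervals
        (hε.1.intervalIntegrable x y) (hε.1.intervalIntegrable y z),
        ← intervalIntegral.integral_add_adjacent_intervals
        (hε.2.intervalIntegrable x y) (hε.2.intervalIntegrable y z)]
      ring))
    (fun x y c h => h.neg.congr fun ε => by
      rw [intervalIntegral.integral_symm x y, intervalIntegral.integral_symm x y]; ring)
    (hfin.toFinset.image Prod.snd)
    (fun s hs => by
      obtain ⟨z, hz, rfl⟩ := Finset.mem_image.1 hs
      exact (hfin.mem_toFinset.1 hz).2.1)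
    (A.jump_periodic_right B p₀)
    (fun q hq => Finset.mem_image.2 ⟨_, hfin.mem_toFinset.2
      (A.fract_mem_meetings B (A.meets_of_jump_ne_zero B hq)), rfl⟩)
    (fun q => A.eventually_tendsto_jump B p₀ q (htr' p₀ q))
  refine hc.congr fun ε => ?_
  have hper : ∀ p, ∫ t in c..c + 1, A.kernel B p t = A.thirdKind B p := fun p => by
    rw [(A.kernel_periodic_right B p).intervalIntegral_add_eq c 0, zero_add]; rfl
  rw [hper, hper]

/-- The Riemann bilinear relation between `dx / y` and `x dx / y`. -/
theorem bilinear_relation (hfin : (A.meetings B).Finite)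
    (htr : ∀ z ∈ A.meetings B, A.area B z.1 z.2 ≠ 0) :
    A.periodSecond * B.periodFirst - A.periodFirst * B.periodSecond =
      -(8 * Real.pi * Complex.I) *
        ∑ z ∈ hfin.toFinset, ((SignType.sign (A.area B z.1 z.2) : ℤ) : ℂ) := by
  set φ : ℝ → ℂ := fun p => deriv A.x p / A.y p / 2 * (A.x p * B.periodFirst - B.periodSecond)
    with hφ
  have hA := A.continuous_form
  have hAx := A.continuous_x
  have hφc : Continuous φ := by fun_prop
  -- Removing a primitive of the derivative leaves a function locally constant off the meeting
  -- times, so all its variation is in the jumps.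
  set H : ℝ → ℂ := fun p => A.thirdKind B p - ∫ t in (0 : ℝ)..p, φ t with hH
  have hI : ∀ p, HasDerivAt (fun p => ∫ t in (0 : ℝ)..p, φ t) (φ p) p := fun p =>
    hφc.integral_hasStrictDerivAt 0 p |>.hasDerivAt
  have hHd : ∀ p, (∀ q, ¬ A.Meets B p q) → HasDerivAt H 0 p := fun p hp =>
    ((A.hasDerivAt_thirdKind B hp).sub (hI p)).congr_deriv (sub_self _)
  have hconst : ∀ l r, (∀ p ∈ Ioo l r, ∀ q, ¬ A.Meets B p q) →
      ∀ p ∈ Ioo l r, ∀ p' ∈ Ioo l r, H p = H p' := fun l r h p hp p' hp' =>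
    isOpen_Ioo.is_const_of_deriv_eq_zero isPreconnected_Ioo
      (fun x hx => (hHd x (h x hx)).differentiableAt.differentiableWithinAt)
      (fun x hx => (hHd x (h x hx)).deriv) hp hp'
  obtain ⟨c, hc⟩ := sum_jumps (V := fun p p' c => H p' - H p = c)
    (fun x y z c d h h' => by rw [← h, ← h']; ring)
    (fun x y c h => by rw [← h]; ring)
    (hfin.toFinset.image Prod.fst)
    (fun s hs => by
      obtain ⟨z, hz, rfl⟩ := Finset.mem_image.1 hs
      exact (hfin.mem_toFinset.1 hz).1)
    (J := fun p => ∑ q ∈ hfin.toFinset.image Prod.snd, A.jump B p q)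
    (fun p => Finset.sum_congr rfl fun q _ => A.jump_periodic_left B q p)
    (fun p hp => by
      obtain ⟨q, -, hq⟩ := Finset.exists_ne_zero_of_sum_ne_zero hp
      exact Finset.mem_image.2 ⟨_, hfin.mem_toFinset.2
        (A.fract_mem_meetings B (A.meets_of_jump_ne_zero B hq)), rfl⟩)
    (fun p₀ => by
      have hlim := (tendsto_thirdKind_jump hfin htr p₀).sub
        (tendsto_sub_of_continuousAt (hI p₀).continuousAt)
      rw [sub_zero] at hlim
      obtain ⟨δ, hδ, hs⟩ := Metric.eventually_nhds_iff.1
        (eventually_nhdsWithin_iff.1 (eventually_not_meets_slice hfin p₀))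
      have hl : ∀ p ∈ Ioo (p₀ - δ) p₀, ∀ q, ¬ A.Meets B p q := fun p hp =>
        hs (by rw [Real.dist_eq, abs_lt]; constructor <;> linarith [hp.1, hp.2]) (ne_of_lt hp.2)
      have hr : ∀ p ∈ Ioo p₀ (p₀ + δ), ∀ q, ¬ A.Meets B p q := fun p hp =>
        hs (by rw [Real.dist_eq, abs_lt]; constructor <;> linarith [hp.1, hp.2]) (ne_of_gt hp.1)
      filter_upwards [eventually_Ioo_prod (q₀ := p₀) hδ] with z hz
      -- By local constancy the difference between the two sides of `p₀` equals the difference at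
      -- `p₀ ± ε` for every small `ε`, hence its limit.
      refine tendsto_nhds_unique (tendsto_const_nhds.congr' ?_) hlim
      filter_upwards [Ioo_mem_nhdsGT hδ] with ε hε
      rw [hconst _ _ hl z.1 hz.1 (p₀ - ε) ⟨by linarith [hε.2], by linarith [hε.1]⟩,
        hconst _ _ hr z.2 hz.2 (p₀ + ε) ⟨by linarith [hε.1], by linarith [hε.2]⟩]
      simp only [hH]
      ring)
  have hL : H (c + 1) - H c =
      -((A.periodSecond * B.periodFirst - A.periodFirst * B.periodSecond) / 2) := by
    have hper : Function.Periodic φ 1 := fun p => by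
      simp only [hφ, A.periodic_deriv_x p, A.periodic_x p, A.periodic_y p]
    have h1 : (∫ t in (0 : ℝ)..c + 1, φ t) - ∫ t in (0 : ℝ)..c, φ t = ∫ t in (0 : ℝ)..1, φ t := by
      rw [intervalIntegral.integral_interval_sub_left (hφc.intervalIntegrable _ _)
        (hφc.intervalIntegrable _ _), hper.intervalIntegral_add_eq c 0, zero_add]
    have h2 : ∫ t in (0 : ℝ)..1, φ t =
        (A.periodSecond * B.periodFirst - A.periodFirst * B.periodSecond) / 2 := by
      have : ∀ t, φ t = B.periodFirst / 2 * (A.x t * (deriv A.x t / A.y t))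
          - B.periodSecond / 2 * (deriv A.x t / A.y t) := fun t => by
        simp only [hφ]; ring
      simp only [this]
      rw [intervalIntegral.integral_sub, intervalIntegral.integral_const_mul,
        intervalIntegral.integral_const_mul]
      · simp only [periodFirst, periodSecond]; ring
      all_goals exact Continuous.intervalIntegrable (by fun_prop) _ _
    rw [← h2, ← h1]
    simp only [hH, A.thirdKind_periodic B c]
    ring
  have hS : ∑ p ∈ hfin.toFinset.image Prod.fst, ∑ q ∈ hfin.toFinset.image Prod.snd, A.jump B p q =
      4 * Real.pi * Complex.I *
        ∑ z ∈ hfin.toFinset, ((SignType.sign (A.area B z.1 z.2) : ℤ) : ℂ) := by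
    -- Both sums range over projections of the meeting set; pairs in the product that are not
    -- meetings have zero jump.
    rw [← Finset.sum_product', Finset.mul_sum]
    symm
    refine Finset.sum_subset_zero_on_sdiff (f := fun z : ℝ × ℝ => 4 * Real.pi * Complex.I * ((SignType.sign (A.area B z.1 z.2) : ℤ) : ℂ)) (fun z hz => ?_) (fun z hz => ?_) fun z hz => ?_
    · exact Finset.mem_product.2 ⟨Finset.mem_image_of_mem _ hz, Finset.mem_image_of_mem _ hz⟩
    · obtain ⟨h1, h2⟩ := Finset.mem_sdiff.1 hz
      obtain ⟨h3, h4⟩ := Finset.mem_product.1 h1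
      obtain ⟨w, hw, hw'⟩ := Finset.mem_image.1 h3
      obtain ⟨v, hv, hv'⟩ := Finset.mem_image.1 h4
      refine if_neg fun hm => h2 (hfin.mem_toFinset.2 ⟨?_, ?_, hm⟩)
      · rw [← hw']; exact (hfin.mem_toFinset.1 hw).1
      · rw [← hv']; exact (hfin.mem_toFinset.1 hv).2.1
    · exact (if_pos (hfin.mem_toFinset.1 hz).2.2).symm
  rw [hL, hS] at hc
  linear_combination -2 * hc

end CubicLoop
/-! ### Differentiating periods with respect to the parameters -/

/-- The linear form `(h₁, h₂) ↦ a h₁ + b h₂`. -/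
def linForm (a b : ℂ) : ℂ × ℂ →L[ℂ] ℂ :=
  a • ContinuousLinearMap.fst ℂ ℂ ℂ + b • ContinuousLinearMap.snd ℂ ℂ ℂ

theorem linForm_apply (a b : ℂ) (h : ℂ × ℂ) : linForm a b h = a * h.1 + b * h.2 := rfl

theorem det_linForm_prod (a b c d : ℂ) :
    ((linForm a b).prod (linForm c d)).det = a * d - b * c := by
  rw [ContinuousLinearMap.det, ← LinearMap.det_toMatrix (Module.Basis.finTwoProd ℂ),
    Matrix.det_fin_two]
  simp [LinearMap.toMatrix_apply, linForm_apply]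

theorem continuousAt_linForm {X : Type*} [TopologicalSpace X] {f g : X → ℂ} {x : X}
    (hf : ContinuousAt f x) (hg : ContinuousAt g x) : ContinuousAt (fun y => linForm (f y) (g y)) x :=
  (hf.smul continuousAt_const).add (hg.smul continuousAt_const)

namespace CycleFamily

variable {q : ℂ × ℂ → ℂ → ℂ} {U : Set (ℂ × ℂ)} (c : CycleFamily q U)

theorem hasDerivAt_x (t : ℝ) : HasDerivAt c.x (deriv c.x t) t :=
  (c.contDiff_x.differentiable one_ne_zero t).hasDerivAt

theorem continuous_deriv_x : Continuous (deriv c.x) := c.contDiff_x.continuous_deriv le_rfl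

theorem continuousAt_w (hU : IsOpen U) {z : (ℂ × ℂ) × ℝ} (hz : z.1 ∈ U) :
    ContinuousAt (fun z : (ℂ × ℂ) × ℝ => c.w z.1 z.2) z :=
  c.continuousOn_w.continuousAt ((hU.prod isOpen_univ).mem_nhds ⟨hz, mem_univ _⟩)

theorem continuous_w (hU : IsOpen U) {u : ℂ × ℂ} (hu : u ∈ U) : Continuous (c.w u) :=
  continuous_iff_continuousAt.2 fun t =>
    ContinuousAt.comp (f := fun t => (u, t)) (c.continuousAt_w hU (z := (u, t)) hu) (by fun_prop)

/-- The period of `∂v` when `r` is the corresponding derivative of `q`. -/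
def periodDeriv (r : ℂ × ℂ → ℂ → ℂ) (u : ℂ × ℂ) : ℂ :=
  ∫ t in (0 : ℝ)..1, r u (c.x t) / (2 * c.w u t) * deriv c.x t

variable {q₁ q₂ : ℂ × ℂ → ℂ → ℂ}

theorem continuousAt_integrand (hU : IsOpen U) {r : ℂ × ℂ → ℂ → ℂ} {z : (ℂ × ℂ) × ℝ} (hz : z.1 ∈ U)
    (hr : ContinuousAt (fun z : (ℂ × ℂ) × ℝ => r z.1 (c.x z.2)) z) :
    ContinuousAt (fun z : (ℂ × ℂ) × ℝ => r z.1 (c.x z.2) / (2 * c.w z.1 z.2) * deriv c.x z.2) z :=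
  (hr.div (continuousAt_const.mul (c.continuousAt_w hU hz))
    (mul_ne_zero two_ne_zero (c.w_ne_zero _ hz _))).mul
    (c.continuous_deriv_x.comp continuous_snd).continuousAt

theorem eventually_fst_mem (hU : IsOpen U) {u : ℂ × ℂ} (hu : u ∈ U) (t : ℝ) :
    ∀ᶠ z : (ℂ × ℂ) × ℝ in 𝓝 (u, t), z.1 ∈ U :=
  continuousAt_fst.eventually (hU.mem_nhds hu)

theorem continuousAt_periodDeriv (hU : IsOpen U) {r : ℂ × ℂ → ℂ → ℂ}
    (hr : ∀ z : (ℂ × ℂ) × ℝ, z.1 ∈ U → ContinuousAt (fun z : (ℂ × ℂ) × ℝ => r z.1 (c.x z.2)) z)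
    {u : ℂ × ℂ} (hu : u ∈ U) : ContinuousAt (c.periodDeriv r) u :=
  continuousAt_parametric_integral fun t _ => (eventually_fst_mem hU hu t).mono fun z hz =>
    c.continuousAt_integrand hU hz (hr z hz)

theorem hasFDerivAt_period (hU : IsOpen U)
    (h1 : ∀ z : (ℂ × ℂ) × ℝ, z.1 ∈ U → ContinuousAt (fun z : (ℂ × ℂ) × ℝ => q₁ z.1 (c.x z.2)) z)
    (h2 : ∀ z : (ℂ × ℂ) × ℝ, z.1 ∈ U → ContinuousAt (fun z : (ℂ × ℂ) × ℝ => q₂ z.1 (c.x z.2)) z)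
    (hd : ∀ u ∈ U, ∀ t,
      HasFDerivAt (fun u => q u (c.x t)) (linForm (q₁ u (c.x t)) (q₂ u (c.x t))) u)
    {u : ℂ × ℂ} (hu : u ∈ U) :
    HasFDerivAt c.period (linForm (c.periodDeriv q₁ u) (c.periodDeriv q₂ u)) u := by
  set F' : ℂ × ℂ → ℝ → ℂ × ℂ →L[ℂ] ℂ := fun u t =>
    linForm (q₁ u (c.x t) / (2 * c.w u t) * deriv c.x t)
      (q₂ u (c.x t) / (2 * c.w u t) * deriv c.x t) with hF'
  have hc : ∀ z : (ℂ × ℂ) × ℝ, z.1 ∈ U → ContinuousAt (Function.uncurry F') z := fun z hz =>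
    continuousAt_linForm (c.continuousAt_integrand hU hz (h1 z hz))
      (c.continuousAt_integrand hU hz (h2 z hz))
  have hcd : Continuous (fun z : (ℂ × ℂ) × ℝ => deriv c.x z.2) :=
    c.continuous_deriv_x.comp continuous_snd
  have key := hasFDerivAt_parametric_integral (a := 0) (b := 1) (x₀ := u)
    (F := fun u t => c.w u t * deriv c.x t) (F' := F')
    (fun t _ => (eventually_fst_mem hU hu t).mono fun z hz =>
      (c.continuousAt_w hU hz).mul hcd.continuousAt)
    (fun t _ => (eventually_fst_mem hU hu t).mono fun z hz => hc z hz)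
    (fun t _ => (eventually_fst_mem hU hu t).mono fun z hz => by
      have hw : ContinuousAt (fun u => c.w u z.2) z.1 :=
        ContinuousAt.comp (f := fun u => (u, z.2)) (c.continuousAt_w hU (z := (z.1, z.2)) hz)
          (by fun_prop)
      have := (hasFDerivAt_of_sq_eq hw (c.w_ne_zero _ hz _)
        (by filter_upwards [hU.mem_nhds hz] with v hv using c.sq_w v hv z.2)
        (hd z.1 hz z.2)).mul_const (deriv c.x z.2)
      refine this.congr_fderiv (ContinuousLinearMap.ext fun h => ?_)
      simp only [hF', linForm_apply, _root_.smul_apply, smul_eq_mul]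
      ring)
  refine key.congr_fderiv ?_
  have hi : ∀ r : ℂ × ℂ → ℂ → ℂ, (∀ z : (ℂ × ℂ) × ℝ, z.1 ∈ U →
      ContinuousAt (fun z : (ℂ × ℂ) × ℝ => r z.1 (c.x z.2)) z) →
      Continuous fun t => r u (c.x t) / (2 * c.w u t) * deriv c.x t := fun r hr =>
    continuous_iff_continuousAt.2 fun t => ContinuousAt.comp (f := fun t => (u, t))
      (c.continuousAt_integrand hU (z := (u, t)) hu (hr _ hu)) (by fun_prop)
  have e1 := hi q₁ h1
  have e2 := hi q₂ h2
  simp only [hF', linForm]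
  rw [intervalIntegral.integral_add, intervalIntegral.integral_smul_const,
    intervalIntegral.integral_smul_const]
  · rfl
  · exact (e1.smul continuous_const).intervalIntegrable _ _
  · exact (e2.smul continuous_const).intervalIntegrable _ _

end CycleFamily

/-- The intersection number of a canonical pair is a sum over finitely many transversal crossings. -/
theorem IsCanonicalPair.finite_crossings {q : ℂ × ℂ → ℂ → ℂ} {U : Set (ℂ × ℂ)}
    {a b : CycleFamily q U} {u : ℂ × ℂ} (h : IsCanonicalPair a b u) : (crossings a b u).Finite := by
  by_contra hinf
  have hsupp : crossings a b u ∩ Function.support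
      (fun p => ((SignType.sign (crossingArea a b p) : SignType) : ℤ)) = crossings a b u := by
    refine inter_eq_left.2 fun p hp => ?_
    have key : ∀ s : SignType, s ≠ 0 → (s : ℤ) ≠ 0 := by decide
    exact key _ (sign_ne_zero.2 (h.1 p hp))
  -- A `finsum` with infinite support is `0` by convention, so intersection number `1` forces
  -- finitely many crossings.
  have h0 : intersectionNumber a b u = 0 :=
    finsum_mem_eq_zero_of_infinite (by rw [hsupp]; exact hinf)
  rw [h.2] at h0
  exact one_ne_zero h0

/-- The bilinear relation for a canonical pair which is carried to loops on a cubic curve. -/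
theorem IsCanonicalPair.bilinear_relation {q : ℂ × ℂ → ℂ → ℂ} {U : Set (ℂ × ℂ)}
    {a b : CycleFamily q U} {u : ℂ × ℂ} (h : IsCanonicalPair a b u) {c₂ c₁ c₀ : ℂ}
    {A B : CubicLoop c₂ c₁ c₀} (hA : A.x = a.x) (hB : B.x = b.x)
    (hm : ∀ p r, A.Meets B p r ↔ a.x p = b.x r ∧ a.w u p = b.w u r) :
    A.periodSecond * B.periodFirst - A.periodFirst * B.periodSecond =
      -(8 * Real.pi * Complex.I) := by
  have hset : A.meetings B = crossings a b u := by
    ext z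
    simp only [CubicLoop.meetings, crossings, hm, mem_ofPred_eq]
  have harea : ∀ z : ℝ × ℝ, A.area B z.1 z.2 = crossingArea a b z := fun z => by
    simp only [CubicLoop.area, crossingArea, hA, hB]
  have hfin : (A.meetings B).Finite := hset ▸ h.finite_crossings
  have htr : ∀ z ∈ A.meetings B, A.area B z.1 z.2 ≠ 0 := fun z hz => by
    rw [harea]; exact h.1 z (hset ▸ hz)
  rw [CubicLoop.bilinear_relation hfin htr]
  have hI : ∑ z ∈ hfin.toFinset, ((SignType.sign (A.area B z.1 z.2) : SignType) : ℤ) = 1 := by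
    rw [← h.2, intersectionNumber, ← finsum_mem_eq_finite_toFinset_sum _ hfin, hset]
    exact finsum_mem_congr rfl fun z _ => by rw [harea]
  rw [← Int.cast_sum, hI, Int.cast_one, mul_one]

/-! ### The family `Q_0(-7, [1]^3)` -/

theorem q7_eq (u : ℂ × ℂ) (x : ℂ) :
    q7 u x = x ^ 3 + 0 * x ^ 2 + (u.1 * u.2 - (u.1 + u.2) ^ 2) * x + u.1 * u.2 * (u.1 + u.2) := by
  simp only [q7, zeros7, Matrix.cons_val]
  ring

/-- Moving `x₁` moves `x₃` oppositely, so the quadratic terms in `x` cancel and the factor `x₃ - x₁`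
appears. The derivative of `v` is thus a combination of `dx/y` and `x dx/y`. -/
def q7d₁ (u : ℂ × ℂ) (x : ℂ) : ℂ := (-2 * u.1 - u.2) * (x - u.2)

def q7d₂ (u : ℂ × ℂ) (x : ℂ) : ℂ := (-2 * u.2 - u.1) * (x - u.1)

theorem hasFDerivAt_q7 (u : ℂ × ℂ) (x : ℂ) :
    HasFDerivAt (fun u => q7 u x) (linForm (q7d₁ u x) (q7d₂ u x)) u := by
  simp only [q7_eq]
  have h1 : HasFDerivAt (fun u : ℂ × ℂ => u.1) (ContinuousLinearMap.fst ℂ ℂ ℂ) u := hasFDerivAt_fst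
  have h2 : HasFDerivAt (fun u : ℂ × ℂ => u.2) (ContinuousLinearMap.snd ℂ ℂ ℂ) u := hasFDerivAt_snd
  have := ((((h1.mul h2).sub ((h1.add h2).pow 2)).mul_const x).const_add (x ^ 3 + 0 * x ^ 2)).add
    ((h1.mul h2).mul (h1.add h2))
  refine this.congr_fderiv (ContinuousLinearMap.ext fun h => ?_)
  simp [linForm_apply, q7d₁, q7d₂]
  ring

section Family7

variable {U : Set (ℂ × ℂ)} (c : CycleFamily q7 U)

/-- The loop of a cycle family at one parameter. -/
def cubicLoop7 (hU : IsOpen U) {u : ℂ × ℂ} (hu : u ∈ U) :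
    CubicLoop 0 (u.1 * u.2 - (u.1 + u.2) ^ 2) (u.1 * u.2 * (u.1 + u.2)) where
  x := c.x
  y := c.w u
  contDiff_x := c.contDiff_x
  continuous_y := c.continuous_w hU hu
  periodic_x := c.periodic_x
  periodic_y := c.periodic_w u hu
  sq_y t := by rw [c.sq_w u hu, q7_eq]
  y_ne_zero := c.w_ne_zero u hu

theorem continuous_q7d₁ : Continuous (fun z : (ℂ × ℂ) × ℝ => q7d₁ z.1 (c.x z.2)) := by
  have := c.contDiff_x.continuous
  unfold q7d₁
  fun_prop

theorem continuous_q7d₂ : Continuous (fun z : (ℂ × ℂ) × ℝ => q7d₂ z.1 (c.x z.2)) := by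
  have := c.contDiff_x.continuous
  unfold q7d₂
  fun_prop

theorem hasFDerivAt_period7 (hU : IsOpen U) {u : ℂ × ℂ} (hu : u ∈ U) :
    HasFDerivAt c.period (linForm (c.periodDeriv q7d₁ u) (c.periodDeriv q7d₂ u)) u :=
  c.hasFDerivAt_period hU (fun _ _ => (continuous_q7d₁ c).continuousAt)
    (fun _ _ => (continuous_q7d₂ c).continuousAt) (fun u _ t => hasFDerivAt_q7 u (c.x t)) hu

theorem CubicLoop.integral_linear {c₂ c₁ c₀ : ℂ} (A : CubicLoop c₂ c₁ c₀) (k e : ℂ) :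
    ∫ t in (0 : ℝ)..1, k * (A.x t - e) / (2 * A.y t) * deriv A.x t =
      k / 2 * (A.periodSecond - e * A.periodFirst) := by
  have hA := A.continuous_form
  have hAx := A.continuous_x
  have h : ∀ t, k * (A.x t - e) / (2 * A.y t) * deriv A.x t =
      k / 2 * (A.x t * (deriv A.x t / A.y t) - e * (deriv A.x t / A.y t)) := fun t => by
    have := A.y_ne_zero t
    field_simp
  simp only [h]
  rw [intervalIntegral.integral_const_mul, intervalIntegral.integral_sub,
    intervalIntegral.integral_const_mul]
  · rfl
  all_goals exact Continuous.intervalIntegrable (by fun_prop) _ _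

/-- The determinant is `(x₃ - x₁)(x₃ - x₂)/4 · (x₂ - x₁)` times the bilinear expression `-8πi`. -/
theorem jacobian7_eq (a b : CycleFamily q7 U) (hU : IsOpen U) {u : ℂ × ℂ} (hu : u ∈ U)
    (h : IsCanonicalPair a b u) :
    a.periodDeriv q7d₁ u * b.periodDeriv q7d₂ u - a.periodDeriv q7d₂ u * b.periodDeriv q7d₁ u =
      2 * Real.pi * Complex.I * sqrtDisc u := by
  have key := h.bilinear_relation (A := cubicLoop7 a hU hu) (B := cubicLoop7 b hU hu) rfl rfl
    (fun _ _ => Iff.rfl)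
  have e1 : ∀ c : CycleFamily q7 U, c.periodDeriv q7d₁ u = (-2 * u.1 - u.2) / 2 *
      ((cubicLoop7 c hU hu).periodSecond - u.2 * (cubicLoop7 c hU hu).periodFirst) := fun c =>
    (cubicLoop7 c hU hu).integral_linear _ _
  have e2 : ∀ c : CycleFamily q7 U, c.periodDeriv q7d₂ u = (-2 * u.2 - u.1) / 2 *
      ((cubicLoop7 c hU hu).periodSecond - u.1 * (cubicLoop7 c hU hu).periodFirst) := fun c =>
    (cubicLoop7 c hU hu).integral_linear _ _
  rw [e1, e1, e2, e2]
  simp only [sqrtDisc, zeros7, Matrix.cons_val]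
  linear_combination (-2 * u.1 - u.2) / 2 * ((-2 * u.2 - u.1) / 2) * (u.2 - u.1) * key

end Family7

/-! ### The family `Q_0([-3]^2, [1]^2)` -/

def q33d₁ (u : ℂ × ℂ) (x : ℂ) : ℂ := -(x - u.2) / x ^ 3

def q33d₂ (u : ℂ × ℂ) (x : ℂ) : ℂ := -(x - u.1) / x ^ 3

theorem hasFDerivAt_q33 (u : ℂ × ℂ) (x : ℂ) :
    HasFDerivAt (fun u => q33 u x) (linForm (q33d₁ u x) (q33d₂ u x)) u := by
  have h1 : HasFDerivAt (fun u : ℂ × ℂ => u.1) (ContinuousLinearMap.fst ℂ ℂ ℂ) u := hasFDerivAt_fst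
  have h2 : HasFDerivAt (fun u : ℂ × ℂ => u.2) (ContinuousLinearMap.snd ℂ ℂ ℂ) u := hasFDerivAt_snd
  have := ((h1.const_sub x).mul (h2.const_sub x)).mul_const ((x ^ 3)⁻¹)
  simp only [q33, div_eq_mul_inv]
  refine this.congr_fderiv (ContinuousLinearMap.ext fun h => ?_)
  simp [linForm_apply, q33d₁, q33d₂]
  ring

section Family33

variable {U : Set (ℂ × ℂ)} (c : CycleFamily q33 U)

theorem x_ne_zero33 {u : ℂ × ℂ} (hu : u ∈ U) (t : ℝ) : c.x t ≠ 0 := fun h => by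
  have := c.sq_w u hu t
  rw [h, q33] at this
  exact c.w_ne_zero u hu t (by simpa using this)

/-- The loop `(x, x² w)` on `y² = x (x - x₁) (x - x₂)`. -/
def cubicLoop33 (hU : IsOpen U) {u : ℂ × ℂ} (hu : u ∈ U) :
    CubicLoop (-(u.1 + u.2)) (u.1 * u.2) 0 where
  x := c.x
  y t := c.x t ^ 2 * c.w u t
  contDiff_x := c.contDiff_x
  continuous_y := (c.contDiff_x.continuous.pow 2).mul (c.continuous_w hU hu)
  periodic_x := c.periodic_x
  periodic_y t := by simp only [c.periodic_x t, c.periodic_w u hu t]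
  sq_y t := by
    have := x_ne_zero33 c hu t
    rw [mul_pow, c.sq_w u hu, q33]
    field_simp
    ring
  y_ne_zero t := mul_ne_zero (pow_ne_zero 2 (x_ne_zero33 c hu t)) (c.w_ne_zero u hu t)

theorem continuousAt_q33d₁ {z : (ℂ × ℂ) × ℝ} (hz : z.1 ∈ U) :
    ContinuousAt (fun z : (ℂ × ℂ) × ℝ => q33d₁ z.1 (c.x z.2)) z := by
  have h : Continuous (fun z : (ℂ × ℂ) × ℝ => c.x z.2) := c.contDiff_x.continuous.comp continuous_snd
  unfold q33d₁
  exact ((h.sub (by fun_prop)).neg.continuousAt).div (h.pow 3).continuousAt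
    (pow_ne_zero 3 (x_ne_zero33 c hz _))

theorem continuousAt_q33d₂ {z : (ℂ × ℂ) × ℝ} (hz : z.1 ∈ U) :
    ContinuousAt (fun z : (ℂ × ℂ) × ℝ => q33d₂ z.1 (c.x z.2)) z := by
  have h : Continuous (fun z : (ℂ × ℂ) × ℝ => c.x z.2) := c.contDiff_x.continuous.comp continuous_snd
  unfold q33d₂
  exact ((h.sub (by fun_prop)).neg.continuousAt).div (h.pow 3).continuousAt
    (pow_ne_zero 3 (x_ne_zero33 c hz _))

theorem hasFDerivAt_period33 (hU : IsOpen U) {u : ℂ × ℂ} (hu : u ∈ U) :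
    HasFDerivAt c.period (linForm (c.periodDeriv q33d₁ u) (c.periodDeriv q33d₂ u)) u :=
  c.hasFDerivAt_period hU (fun _ hz => continuousAt_q33d₁ c hz)
    (fun _ hz => continuousAt_q33d₂ c hz) (fun u _ t => hasFDerivAt_q33 u (c.x t)) hu

/-- `x dx / y` is cohomologous to `c₁ dx / (x y)` on `y² = x³ + c₂ x² + c₁ x`. -/
theorem CubicLoop.periodSecond_eq {c₂ c₁ : ℂ} (A : CubicLoop c₂ c₁ 0) :
    A.periodSecond = c₁ * ∫ t in (0 : ℝ)..1, deriv A.x t / (A.x t * A.y t) := by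
  have hx0 : ∀ t, A.x t ≠ 0 := fun t h => A.y_ne_zero t (by
    have := A.sq_y t
    simpa [h] using this)
  have hA := A.continuous_form
  have hAx := A.continuous_x
  have hc : Continuous fun t => deriv A.x t / (A.x t * A.y t) :=
    A.continuous_deriv_x.div (hAx.mul A.continuous_y) fun t => mul_ne_zero (hx0 t) (A.y_ne_zero t)
  have h1 := intervalIntegral.integral_eq_sub_of_hasDerivAt (a := 0) (b := 1)
    -- The exact form is `d(2y/x) = x dx/y - c₁ dx/(xy)`; it uses `c₀ = 0`.
    (f := fun t => 2 * (A.y t / A.x t))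
    (f' := fun t => A.x t * (deriv A.x t / A.y t) - c₁ * (deriv A.x t / (A.x t * A.y t)))
    (fun t _ => (((A.hasDerivAt_y t).div (A.hasDerivAt_x t) (hx0 t)).const_mul 2).congr_deriv (by
      have h1 := A.y_ne_zero t
      have h2 := hx0 t
      field_simp
      linear_combination -2 * deriv A.x t * A.sq_y t)) (Continuous.intervalIntegrable (by fun_prop) _ _)
  have hx1 := A.periodic_x 0
  have hy1 := A.periodic_y 0
  rw [zero_add] at hx1 hy1
  rw [hx1, hy1, sub_self, intervalIntegral.integral_sub, intervalIntegral.integral_const_mul,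
    sub_eq_zero] at h1
  · exact h1
  all_goals exact Continuous.intervalIntegrable (by fun_prop) _ _

theorem periodDeriv33 (hU : IsOpen U) {u : ℂ × ℂ} (hu : u ∈ U) (e : ℂ) :
    ∫ t in (0 : ℝ)..1, -(c.x t - e) / c.x t ^ 3 / (2 * c.w u t) * deriv c.x t =
      -(1 / 2) * ((cubicLoop33 c hU hu).periodFirst -
        e * ∫ t in (0 : ℝ)..1, deriv (cubicLoop33 c hU hu).x t /
          ((cubicLoop33 c hU hu).x t * (cubicLoop33 c hU hu).y t)) := by
  set A := cubicLoop33 c hU hu with hAdef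
  have hA := A.continuous_form
  have hc : Continuous fun t => deriv A.x t / (A.x t * A.y t) :=
    A.continuous_deriv_x.div (A.continuous_x.mul A.continuous_y)
      fun t => mul_ne_zero (x_ne_zero33 c hu t) (A.y_ne_zero t)
  have h : ∀ t, -(c.x t - e) / c.x t ^ 3 / (2 * c.w u t) * deriv c.x t =
      -(1 / 2) * (deriv A.x t / A.y t - e * (deriv A.x t / (A.x t * A.y t))) := fun t => by
    have h1 := x_ne_zero33 c hu t
    have h2 := c.w_ne_zero u hu t
    simp only [hAdef, cubicLoop33]
    field_simp
  simp only [h]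
  rw [intervalIntegral.integral_const_mul, intervalIntegral.integral_sub,
    intervalIntegral.integral_const_mul]
  · rfl
  all_goals exact Continuous.intervalIntegrable (by fun_prop) _ _

/-- With `τ` the period of `dx/(xy)`, the determinant is `(x₁ - x₂)/4 · (τ_A ω_B - ω_A τ_B)`. Since
`η = x₁x₂ τ`, the bilinear relation makes the last factor `-8πi/(x₁x₂)`. -/
theorem jacobian33_eq (a b : CycleFamily q33 U) (hU : IsOpen U) {u : ℂ × ℂ} (hu : u ∈ U)
    (h1 : u.1 ≠ 0) (h2 : u.2 ≠ 0) (h : IsCanonicalPair a b u) :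
    a.periodDeriv q33d₁ u * b.periodDeriv q33d₂ u - a.periodDeriv q33d₂ u * b.periodDeriv q33d₁ u =
      -(2 * Real.pi * Complex.I * ((u.1 - u.2) / (u.1 * u.2))) := by
  have key := h.bilinear_relation (A := cubicLoop33 a hU hu) (B := cubicLoop33 b hU hu) rfl rfl
    -- Over a common `x ≠ 0` the map `w ↦ x² w` is injective, so no meetings are gained or lost on
    -- the cubic.
    (fun p r => by
      refine and_congr_right fun hx => ?_
      have hx' : a.x p = b.x r := hx
      have h0 := pow_ne_zero 2 (x_ne_zero33 b hu r)
      simp only [cubicLoop33, hx', mul_right_inj' h0])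
  rw [CubicLoop.periodSecond_eq, CubicLoop.periodSecond_eq] at key
  have e1 := fun c : CycleFamily q33 U => periodDeriv33 c hU hu u.2
  have e2 := fun c : CycleFamily q33 U => periodDeriv33 c hU hu u.1
  simp only [CycleFamily.periodDeriv, q33d₁, q33d₂]
  rw [e1, e1, e2, e2]
  field_simp
  linear_combination (u.1 - u.2) * key

end Family33

/-! ### Local coordinates on finite quotients -/

/-- The quotient by a relation given by finitely many maps, each of which is the identity or moves
`p`, is an open embedding near `p`. -/
theorem exists_isOpenEmbedding_quotient {X ι : Type*} [TopologicalSpace X] [T2Space X] [Finite ι]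
    {D : Set X} (s : Setoid D) (g : ι → X → X) (hg : ∀ i, Continuous (g i))
    (hs : ∀ u u' : D, s u u' ↔ ∃ i, u'.1 = g i u.1) {p : X}
    (hp : ∀ i, g i = id ∨ g i p ≠ p) :
    ∃ V ∈ 𝓝 p, ∀ W, IsOpen W → W ⊆ V → ∀ h : W ⊆ D,
      IsOpenEmbedding (fun u : W => Quotient.mk s ⟨u, h u.2⟩) := by
  have hV : ∀ i, ∃ V ∈ 𝓝 p, g i = id ∨ ∀ u ∈ V, g i u ∉ V := fun i => by
    rcases hp i with h | h
    · exact ⟨univ, univ_mem, Or.inl h⟩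
    · obtain ⟨O₁, O₂, h1, h2, hm1, hm2, hd⟩ := t2_separation h
      -- A map moving `p` carries a small neighbourhood of `p` off itself, so it identifies no two
      -- of its points.
      refine ⟨O₂ ∩ g i ⁻¹' O₁, inter_mem (h2.mem_nhds hm2)
        ((hg i).continuousAt.preimage_mem_nhds (h1.mem_nhds hm1)), Or.inr fun u hu hu' => ?_⟩
      exact disjoint_left.1 hd hu.2 hu'.1
  choose V hVp hV using hV
  refine ⟨⋂ i, V i, iInter_mem.2 hVp, fun W hW hWV h => ?_⟩
  refine IsOpenEmbedding.of_continuous_injective_isOpenMap ?_ ?_ ?_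
  · exact continuous_quotient_mk'.comp (by fun_prop)
  · intro u u' huu
    obtain ⟨i, hi⟩ := (hs _ _).1 (Quotient.exact huu)
    rcases hV i with h' | h'
    · rw [h'] at hi
      exact Subtype.ext hi.symm
    · refine absurd ?_ (h' u.1 (mem_iInter.1 (hWV u.2) i))
      have hi' : u'.1 = g i u.1 := hi
      rw [← hi']
      exact mem_iInter.1 (hWV u'.2) i
  · intro O hO
    obtain ⟨O', hO', rfl⟩ := isOpen_induced_iff.1 hO
    rw [← isQuotientMap_quotient_mk'.isOpen_preimage]
    -- The saturation of an open set is a union of preimages under the `g i`, hence open.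
    have : (Quotient.mk s) ⁻¹' ((fun u : W => Quotient.mk s ⟨u, h u.2⟩) '' (Subtype.val ⁻¹' O')) =
        ⋃ i, {u' : D | g i u'.1 ∈ O' ∩ W} := by
      ext u'
      simp only [mem_preimage, mem_image, mem_iUnion]
      constructor
      · rintro ⟨u, hu, he⟩
        obtain ⟨i, hi⟩ := (hs _ _).1 (s.symm (Quotient.exact he))
        have hi' : u.1 = g i u'.1 := hi
        exact ⟨i, hi' ▸ hu, hi' ▸ u.2⟩
      · rintro ⟨i, h1, h2⟩
        exact ⟨⟨g i u'.1, h2⟩, h1, Quotient.sound (s.symm ((hs _ _).2 ⟨i, rfl⟩))⟩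
    change IsOpen ((Quotient.mk s) ⁻¹' _)
    rw [this]
    exact isOpen_iUnion fun i => (hO'.inter hW).preimage ((hg i).comp continuous_subtype_val)

theorem continuousAt_clm_prod {X : Type*} [TopologicalSpace X] {f g : X → ℂ × ℂ →L[ℂ] ℂ} {x : X}
    (hf : ContinuousAt f x) (hg : ContinuousAt g x) : ContinuousAt (fun y => (f y).prod (g y)) x :=
  ((ContinuousLinearMap.prodₗᵢ ℂ (𝕜 := ℂ) (E := ℂ × ℂ) (F := ℂ) (G := ℂ)).continuous.continuousAt).comp
    (hf.prodMk hg)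

/-- A map with continuous invertible derivative gives local coordinates on a space that is locally
parametrized by its domain. -/
theorem isLocalCoordinatesAt_of_hasFDerivAt {M : Type*} [TopologicalSpace M] {D U V : Set (ℂ × ℂ)}
    {cls : D → M} {F : ℂ × ℂ → ℂ × ℂ} {F' : ℂ × ℂ → ℂ × ℂ →L[ℂ] ℂ × ℂ} {p : ℂ × ℂ}
    (hU : IsOpen U) (hUD : U ⊆ D) (hp : p ∈ U) (hF : ∀ u ∈ U, HasFDerivAt F (F' u) u)
    (hF' : ∀ u ∈ U, ContinuousAt F' u) (hdet : (F' p).det ≠ 0) (hV : V ∈ 𝓝 p)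
    (hcls : ∀ W, IsOpen W → W ⊆ V → ∀ h : W ⊆ D, IsOpenEmbedding (fun u : W => cls ⟨u, h u.2⟩)) :
    IsLocalCoordinatesAt cls F p := by
  have hdc : ContinuousOn (fun u => (F' u).det) U := fun u hu =>
    (ContinuousAt.comp (g := fun A : ℂ × ℂ →L[ℂ] ℂ × ℂ => A.det)
      ContinuousLinearMap.continuous_det.continuousAt (hF' u hu)).continuousWithinAt
  have hO : IsOpen (U ∩ (fun u => (F' u).det) ⁻¹' {0}ᶜ) :=
    hdc.isOpen_inter_preimage hU isOpen_compl_singleton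
  -- Restricting to points with invertible derivative makes the inverse differentiable on the whole
  -- target, not only at the image of `p`.
  set O := (U ∩ (fun u => (F' u).det) ⁻¹' {0}ᶜ) ∩ interior V with hOdef
  have hO' : IsOpen O := hO.inter isOpen_interior
  have hpO : p ∈ O := ⟨⟨hp, hdet⟩, mem_interior_iff_mem_nhds.2 hV⟩
  have hstrict : HasStrictFDerivAt F
      ((F' p).toContinuousLinearEquivOfDetNeZero hdet : ℂ × ℂ →L[ℂ] ℂ × ℂ) p := by
    rw [ContinuousLinearMap.coe_toContinuousLinearEquivOfDetNeZero]
    refine hasStrictFDerivAt_of_hasFDerivAt_of_continuousAt ?_ (hF' p hp)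
    filter_upwards [hU.mem_nhds hp] with u hu using hF u hu
  set e := (hstrict.toOpenPartialHomeomorph F).restrOpen O hO' with he
  have hsrc : e.source ⊆ O := fun u hu => hu.2
  have hsD : e.source ⊆ D := fun u hu => hUD (hsrc hu).1.1
  have heF : ∀ u, e u = F u := fun u => rfl
  refine ⟨e, ⟨hstrict.mem_toOpenPartialHomeomorph_source, hpO⟩, fun u _ => heF u,
    fun u hu => ?_, fun v hv => ?_, hsD, hcls _ e.open_source (fun u hu => interior_subset (hsrc hu).2) hsD⟩
  · exact ((hF u (hsrc hu).1.1).differentiableAt).differentiableWithinAt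
  · have hs := hsrc (e.map_target hv)
    have hdv : (F' (e.symm v)).det ≠ 0 := hs.1.2
    have hd : HasFDerivAt e
        ((F' (e.symm v)).toContinuousLinearEquivOfDetNeZero hdv : ℂ × ℂ →L[ℂ] ℂ × ℂ)
        (e.symm v) := by
      rw [ContinuousLinearMap.coe_toContinuousLinearEquivOfDetNeZero]
      exact hF _ hs.1.1
    exact (e.hasFDerivAt_symm hv hd).differentiableAt.differentiableWithinAt

/-! ### The two strata -/

theorem continuous_zeros7 (i : Fin 3) : Continuous fun u => zeros7 u i := by
  fin_cases i <;> simp only [zeros7] <;> simp <;> fun_prop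

theorem sum_zeros7 (u : ℂ × ℂ) : ∑ i, zeros7 u i = 0 := by
  simp only [zeros7, Fin.sum_univ_three, Matrix.cons_val]
  ring

/-- The action of a permutation and a fifth root of unity on `(x₁, x₂)`. -/
def act7 (i : Equiv.Perm (Fin 3) × rootsOfUnity 5 ℂ) (u : ℂ × ℂ) : ℂ × ℂ :=
  ((i.2 : ℂˣ) * zeros7 u (i.1 0), (i.2 : ℂˣ) * zeros7 u (i.1 1))

/-- The third coordinate takes care of itself because the zeros sum to zero. -/
theorem eq_act7_iff (i : Equiv.Perm (Fin 3) × rootsOfUnity 5 ℂ) (u u' : ℂ × ℂ) :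
    u' = act7 i u ↔ ∀ j, zeros7 u' j = (i.2 : ℂˣ) * zeros7 u (i.1 j) := by
  have hsum : ∑ j, zeros7 u (i.1 j) = 0 := by rw [Equiv.sum_comp i.1, sum_zeros7]
  rw [Fin.sum_univ_three] at hsum
  constructor
  · rintro rfl
    rw [Fin.forall_fin_succ, Fin.forall_fin_two]
    refine ⟨rfl, rfl, ?_⟩
    change -((i.2 : ℂˣ) * zeros7 u (i.1 0)) - (i.2 : ℂˣ) * zeros7 u (i.1 1)
      = (i.2 : ℂˣ) * zeros7 u (i.1 2)
    linear_combination -((i.2 : ℂˣ) : ℂ) * hsum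
  · intro h
    exact Prod.ext (h 0) (h 1)

theorem setoid7_iff (u u' : conf7) : setoid7 u u' ↔ ∃ i, u'.1 = act7 i u.1 := by
  simp only [eq_act7_iff]
  constructor
  · rintro ⟨σ, ζ, hζ, h⟩
    exact ⟨(σ, rootsOfUnity.mkOfPowEq ζ hζ), fun j => by simpa using h j⟩
  · rintro ⟨⟨σ, ζ⟩, h⟩
    refine ⟨σ, (ζ : ℂˣ), ?_, h⟩
    have := (mem_rootsOfUnity' 5 (ζ : ℂˣ)).1 ζ.2
    exact this

/-- The group `S₃ × ℤ₅` acts freely on `conf7`. -/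
theorem act7_eq_id {i : Equiv.Perm (Fin 3) × rootsOfUnity 5 ℂ} {u : ℂ × ℂ} (hu : u ∈ conf7)
    (h : act7 i u = u) : act7 i = id := by
  obtain ⟨σ, ζ⟩ := i
  have hz := (eq_act7_iff _ _ _).1 h.symm
  simp only at hz
  set z : ℂ := ((ζ : ℂˣ) : ℂ) with hzdef
  have hz5 : z ^ 5 = 1 := (mem_rootsOfUnity' 5 (ζ : ℂˣ)).1 ζ.2
  have hinj : Function.Injective (zeros7 u) := hu
  have hpow : ∀ n : ℕ, ∀ j, zeros7 u j = z ^ n * zeros7 u ((σ ^ n) j) := fun n => by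
    induction n with
    | zero => intro j; simp
    | succ n ih => intro j; rw [ih j, hz, pow_succ z, pow_succ' σ, Equiv.Perm.mul_apply]; ring
  have h6 : σ ^ 6 = 1 := by
    have := pow_card_eq_one (x := σ)
    rwa [Fintype.card_perm, Fintype.card_fin] at this
  obtain ⟨j, hj⟩ : ∃ j, zeros7 u j ≠ 0 := by
    by_contra! hcon
    exact zero_ne_one (hinj ((hcon (0 : Fin 3)).trans (hcon 1).symm))
  -- The sixth iterate removes the permutation, and a nonzero zero then forces `z ^ 6 = 1`. Together
  -- with `z ^ 5 = 1` this gives `z = 1`, after which distinctness of the zeros kills `σ`.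
  have hz6 : z ^ 6 = 1 := by
    have := hpow 6 j
    rw [h6, Equiv.Perm.one_apply] at this
    exact (mul_eq_right₀ hj).1 this.symm
  have hz1 : z = 1 := by rw [pow_succ, hz5, one_mul] at hz6; exact hz6
  have hσ : σ = 1 := Equiv.ext fun j => hinj (by
    rw [Equiv.Perm.one_apply, hz j, hz1, one_mul])
  funext v
  refine ((eq_act7_iff _ _ _).2 fun j => ?_).symm
  change zeros7 v j = z * zeros7 v (σ j)
  rw [hz1, hσ, one_mul, Equiv.Perm.one_apply]

theorem exists_isOpenEmbedding_cls7 {p : ℂ × ℂ} (hp : p ∈ conf7) :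
    ∃ V ∈ 𝓝 p, ∀ W, IsOpen W → W ⊆ V → ∀ h : W ⊆ conf7,
      IsOpenEmbedding (fun u : W => cls7 ⟨u, h u.2⟩) := by
  refine exists_isOpenEmbedding_quotient setoid7 act7 (fun i => ?_) setoid7_iff fun i => ?_
  · exact (continuous_const.mul (continuous_zeros7 _)).prodMk
      (continuous_const.mul (continuous_zeros7 _))
  · by_cases h : act7 i p = p
    · exact Or.inl (act7_eq_id hp h)
    · exact Or.inr h

theorem exists_isOpenEmbedding_cls33 {p : ℂ × ℂ} (hp : p ∈ conf33) :
    ∃ V ∈ 𝓝 p, ∀ W, IsOpen W → W ⊆ V → ∀ h : W ⊆ conf33,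
      IsOpenEmbedding (fun u : W => cls33 ⟨u, h u.2⟩) := by
  refine exists_isOpenEmbedding_quotient setoid33 (fun b : Bool => cond b id Prod.swap)
    (fun b => ?_) (fun u u' => ?_) fun b => ?_
  · cases b
    · exact continuous_swap
    · exact continuous_id
  · rw [Bool.exists_bool, or_comm]; rfl
  · cases b
    · exact Or.inr fun h => hp.2.2 (congrArg Prod.snd h)
    · exact Or.inl rfl

theorem sqrtDisc_ne_zero {u : ℂ × ℂ} (hu : u ∈ conf7) : sqrtDisc u ≠ 0 := by
  have hinj : Function.Injective (zeros7 u) := hu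
  exact mul_ne_zero (mul_ne_zero (sub_ne_zero.2 (hinj.ne (by decide)))
    (sub_ne_zero.2 (hinj.ne (by decide)))) (sub_ne_zero.2 (hinj.ne (by decide)))

end QuadDiff

end

/-! ### Jacobians and local coordinates on both strata. -/

open QuadDiff in
theorem mainTheorem8 :
    (∀ (U : Set (ℂ × ℂ)), IsOpen U → U ⊆ QuadDiff.conf7 →
      ∀ (a b : QuadDiff.CycleFamily QuadDiff.q7 U), ∀ u ∈ U, QuadDiff.IsCanonicalPair a b u →
        DifferentiableAt ℂ (QuadDiff.periodMap a b) u ∧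
        QuadDiff.jacobian (QuadDiff.periodMap a b) u
          = 2 * Real.pi * Complex.I * QuadDiff.sqrtDisc u ∧
        QuadDiff.jacobian (QuadDiff.halfPeriodMap a b) u
          = Real.pi * Complex.I / 2 * QuadDiff.sqrtDisc u ∧
        QuadDiff.IsLocalCoordinatesAt QuadDiff.cls7 (QuadDiff.periodMap a b) u ∧
        QuadDiff.IsLocalCoordinatesAt QuadDiff.cls7 (QuadDiff.halfPeriodMap a b) u) ∧
    (∀ (U : Set (ℂ × ℂ)), IsOpen U → U ⊆ QuadDiff.conf33 →
      ∀ (a b : QuadDiff.CycleFamily QuadDiff.q33 U), ∀ u ∈ U, QuadDiff.IsCanonicalPair a b u →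
        DifferentiableAt ℂ (QuadDiff.periodMap a b) u ∧
        QuadDiff.jacobian (QuadDiff.periodMap a b) u
          = -(2 * Real.pi * Complex.I * ((u.1 - u.2) / (u.1 * u.2))) ∧
        QuadDiff.IsLocalCoordinatesAt QuadDiff.cls33 (QuadDiff.periodMap a b) u) := by
  have hpi : (Real.pi : ℂ) ≠ 0 := Complex.ofReal_ne_zero.2 Real.pi_ne_zero
  refine ⟨fun U hU hUD a b u hu hab => ?_, fun U hU hUD a b u hu hab => ?_⟩
  · have hd : ∀ v ∈ U, HasFDerivAt (periodMap a b)
        ((linForm (a.periodDeriv q7d₁ v) (a.periodDeriv q7d₂ v)).prod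
          (linForm (b.periodDeriv q7d₁ v) (b.periodDeriv q7d₂ v))) v := fun v hv =>
      (hasFDerivAt_period7 a hU hv).prodMk (hasFDerivAt_period7 b hU hv)
    have hd' : ∀ v ∈ U, HasFDerivAt (halfPeriodMap a b)
        ((linForm (a.periodDeriv q7d₁ v / 2) (a.periodDeriv q7d₂ v / 2)).prod
          (linForm (b.periodDeriv q7d₁ v / 2) (b.periodDeriv q7d₂ v / 2))) v := fun v hv => by
      have := ((hasFDerivAt_period7 a hU hv).mul_const (2⁻¹)).prodMk
        ((hasFDerivAt_period7 b hU hv).mul_const (2⁻¹))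
      refine this.congr_fderiv (ContinuousLinearMap.ext fun h => ?_)
      ext <;> simp [linForm_apply] <;> ring
    have hc₁ : ∀ c : CycleFamily q7 U, ∀ v ∈ U, ContinuousAt (c.periodDeriv q7d₁) v := fun c v hv =>
      c.continuousAt_periodDeriv hU (fun _ _ => (continuous_q7d₁ c).continuousAt) hv
    have hc₂ : ∀ c : CycleFamily q7 U, ∀ v ∈ U, ContinuousAt (c.periodDeriv q7d₂) v := fun c v hv =>
      c.continuousAt_periodDeriv hU (fun _ _ => (continuous_q7d₂ c).continuousAt) hv
    have hJ := jacobian7_eq a b hU hu hab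
    have hdisc := sqrtDisc_ne_zero (hUD hu)
    obtain ⟨V, hV, hcls⟩ := exists_isOpenEmbedding_cls7 (hUD hu)
    have hdet := (det_linForm_prod (a.periodDeriv q7d₁ u) (a.periodDeriv q7d₂ u)
      (b.periodDeriv q7d₁ u) (b.periodDeriv q7d₂ u)).trans hJ
    have hdet' : ((linForm (a.periodDeriv q7d₁ u / 2) (a.periodDeriv q7d₂ u / 2)).prod
          (linForm (b.periodDeriv q7d₁ u / 2) (b.periodDeriv q7d₂ u / 2))).det =
        Real.pi * Complex.I / 2 * sqrtDisc u := by
      rw [det_linForm_prod]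
      -- Halving both periods divides the determinant by four.
      linear_combination hJ / 4
    refine ⟨(hd u hu).differentiableAt, ?_, ?_, ?_, ?_⟩
    · rw [jacobian, (hd u hu).fderiv, hdet]
    · rw [jacobian, (hd' u hu).fderiv, hdet']
    · refine isLocalCoordinatesAt_of_hasFDerivAt hU hUD hu hd (fun v hv => ?_) ?_ hV hcls
      · exact continuousAt_clm_prod (continuousAt_linForm (hc₁ a v hv) (hc₂ a v hv))
          (continuousAt_linForm (hc₁ b v hv) (hc₂ b v hv))
      · rw [hdet]; simp [hpi, hdisc]
    · refine isLocalCoordinatesAt_of_hasFDerivAt hU hUD hu hd' (fun v hv => ?_) ?_ hV hcls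
      · exact continuousAt_clm_prod
          (continuousAt_linForm ((hc₁ a v hv).div_const 2) ((hc₂ a v hv).div_const 2))
          (continuousAt_linForm ((hc₁ b v hv).div_const 2) ((hc₂ b v hv).div_const 2))
      · rw [hdet']; simp [hpi, hdisc]
  · obtain ⟨h1, h2, h12⟩ := hUD hu
    have hd : ∀ v ∈ U, HasFDerivAt (periodMap a b)
        ((linForm (a.periodDeriv q33d₁ v) (a.periodDeriv q33d₂ v)).prod
          (linForm (b.periodDeriv q33d₁ v) (b.periodDeriv q33d₂ v))) v := fun v hv =>
      (hasFDerivAt_period33 a hU hv).prodMk (hasFDerivAt_period33 b hU hv)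
    have hc₁ : ∀ c : CycleFamily q33 U, ∀ v ∈ U, ContinuousAt (c.periodDeriv q33d₁) v :=
      fun c v hv => c.continuousAt_periodDeriv hU (fun _ hz => continuousAt_q33d₁ c hz) hv
    have hc₂ : ∀ c : CycleFamily q33 U, ∀ v ∈ U, ContinuousAt (c.periodDeriv q33d₂) v :=
      fun c v hv => c.continuousAt_periodDeriv hU (fun _ hz => continuousAt_q33d₂ c hz) hv
    obtain ⟨V, hV, hcls⟩ := exists_isOpenEmbedding_cls33 (hUD hu)
    have hdet := (det_linForm_prod (a.periodDeriv q33d₁ u) (a.periodDeriv q33d₂ u)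
      (b.periodDeriv q33d₁ u) (b.periodDeriv q33d₂ u)).trans (jacobian33_eq a b hU hu h1 h2 hab)
    refine ⟨(hd u hu).differentiableAt, ?_, ?_⟩
    · rw [jacobian, (hd u hu).fderiv, hdet]
    · refine isLocalCoordinatesAt_of_hasFDerivAt hU hUD hu hd (fun v hv => ?_) ?_ hV hcls
      · exact continuousAt_clm_prod (continuousAt_linForm (hc₁ a v hv) (hc₂ a v hv))
          (continuousAt_linForm (hc₁ b v hv) (hc₂ b v hv))
      · rw [hdet]; simp [hpi, h1, h2, sub_ne_zero.2 h12]
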